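/- Let $n\in\mathbb{N}$, $p\ge 0$, and let $r=(r_1,\dots,r_n)$ be positive real numbers with dilation map $\delta^r_\lambda(x)=(\lambda^{r_1}x_1,\dots,\lambda^{r_n}x_n)$, $\lambda>0$. Inequalities between vectors are componentwise; $v>0$ (resp. $v<0$) means that all components are positive (resp. negative). Let $f,g:\mathbb{R}^n\to\mathbb{R}^n$ be continuous on $\mathbb{R}^n$, continuously differentiable on $\mathbb{R}^n\setminus\{0\}$, with $f(0)=g(0)=0$, and suppose that 1. $f$ is cooperative: $\frac{\partial f_i}{\partial x_j}(x)\ge 0$ for all $i\ne j$ and all $x\in\mathbb{R}^n_+\setminus\{0\}$; and $g$ is non-decreasing on $\mathbb{R}^n_+$: $g(x)\ge g(y)$ whenever $x\ge y\ge 0$; 2. $f$ and $g$ are homogeneous of degree $p$ with respect to $\delta^r_\lambda$: $f(\delta^r_\lambda(x))=\lambda^p\,\delta^r_\lambda(f(x))$ for all $x\in\mathbb{R}^n$, $\lambda>0$, and likewise for $g$. Call a delay $\tau:[0,\infty)\to[0,\infty)$ admissible if it is continuous and $\lim_{t\to\infty}(t-\tau(t))=+\infty$ ($\tau$ may be unbounded);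 put $\tau_{\max}=-\inf_{t\ge 0}(t-\tau(t))\in[0,\infty)$. For such $\tau$ consider $$\mathcal{G}:\quad \dot x(t)=f(x(t))+g(x(t-\tau(t))),\quad t\ge 0,\qquad x(t)=\varphi(t),\quad t\in[-\tau_{\max},0].$$ We say that $\mathcal{G}$ is globally asymptotically stable for all nonnegative initial conditions if, where $\varphi$ ranges over $\mathcal{C}([-\tau_{\max},0],\mathbb{R}^n_+)$: (a) for every $\varphi$ there is a solution $x$ on $[0,\infty)$; (b) for every $\varepsilon>0$ there is $\delta>0$ such that $\sup_{s\in[-\tau_{\max},0]}\|\varphi(s)\|<\delta$ implies $\|x(t)\|<\varepsilon$ for all $t\ge 0$ and every solution $x$ on $[0,\infty)$; (c) for every $\varphi$, every solution $x$ on $[0,\infty)$ satisfies $x(t)\to 0$ as $t\to\infty$. Then the following statements are equivalent. - (i) There exists a vector $v>0$ such that $f(v)+g(v)<0$. - (ii) For every admissible delay $\tau$, the system $\mathcal{G}$ is globally asymptotically stable for all nonnegative initial conditions. - (iii) The system $\mathcal{G}$ without delay ($\tau(t)=0$ for all $t\ge 0$) is globally asymptotically stable for all nonnegative initial conditions. 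-/

import Mathlib

open Set Filter Topology

/-- The dilation map `x ↦ (lam ^ r₁ * x₁, …, lam ^ rₙ * xₙ)`. -/
noncomputable def dilation {n : ℕ} (r : Fin n → ℝ) (lam : ℝ) (x : Fin n → ℝ) : Fin n → ℝ :=
  fun i => lam ^ r i * x i

/-- Homogeneity of degree `p` with respect to the dilation map with exponents `r`. -/
def IsHomogeneousField {n : ℕ} (r : Fin n → ℝ) (p : ℝ)
    (f : (Fin n → ℝ) → (Fin n → ℝ)) : Prop :=
  ∀ (x : Fin n → ℝ) (lam : ℝ), 0 < lam → f (dilation r lam x) = lam ^ p • dilation r lam (f x)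

/-- The standing regularity of the vector fields: continuous on the whole space, continuously
differentiable away from the origin, and vanishing at the origin. -/
structure IsRegularField {n : ℕ} (f : (Fin n → ℝ) → (Fin n → ℝ)) : Prop where
  continuous : Continuous f
  contDiffOn : ContDiffOn ℝ 1 f {0}ᶜ
  map_zero : f 0 = 0

/-- The Jacobian matrix of `f` is Metzler (nonnegative off-diagonal entries `∂fᵢ/∂xⱼ`) at every
nonzero point of the nonnegative orthant. -/
def HasMetzlerJacobian {n : ℕ} (f : (Fin n → ℝ) → (Fin n → ℝ)) : Prop :=
  ∀ x : Fin n → ℝ, 0 ≤ x → x ≠ 0 → ∀ i j : Fin n, i ≠ j → 0 ≤ fderiv ℝ f x (Pi.single j 1) i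

/-- A cooperative vector field. -/
structure IsCooperative {n : ℕ} (f : (Fin n → ℝ) → (Fin n → ℝ)) : Prop where
  continuous : Continuous f
  contDiffOn : ContDiffOn ℝ 1 f {0}ᶜ
  metzler : HasMetzlerJacobian f

/-- A vector field that is non-decreasing on the nonnegative orthant. -/
def IsNondecreasingField {n : ℕ} (g : (Fin n → ℝ) → (Fin n → ℝ)) : Prop :=
  ∀ x y : Fin n → ℝ, 0 ≤ y → y ≤ x → g y ≤ g x

/-- The admissible delays: `τ : [0, ∞) → [0, ∞)` continuous with `t - τ t → ∞`.  Values of `τ` at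
negative times are irrelevant. -/
structure IsAdmissibleDelay (τ : ℝ → ℝ) : Prop where
  continuousOn : ContinuousOn τ (Ici 0)
  nonneg : ∀ t, 0 ≤ t → 0 ≤ τ t
  tendsto : Tendsto (fun t => t - τ t) atTop atTop

/-- The length `τ_max = - inf_{t ≥ 0} (t - τ t)` of the interval on which the initial condition is
prescribed.  As `t - τ t` is nonpositive at `t = 0` and positive for all `t > T₀`, for some `T₀`,
this is also `- inf_{0 ≤ t ≤ T₀} (t - τ t)`. -/
noncomputable def maxDelay (τ : ℝ → ℝ) : ℝ :=
  - sInf ((fun t => t - τ t) '' Ici 0)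

/-- Nonnegative initial conditions: continuous maps from `[-τ_max, 0]` to the nonnegative
orthant.  Values of `φ` outside this interval are irrelevant. -/
structure IsNonnegInitial {n : ℕ} (τ : ℝ → ℝ) (φ : ℝ → Fin n → ℝ) : Prop where
  continuousOn : ContinuousOn φ (Icc (-maxDelay τ) 0)
  nonneg : ∀ s ∈ Icc (-maxDelay τ) 0, 0 ≤ φ s

/-- `x` solves `x'(t) = f (x(t)) + g (x(t - τ(t)))` for all `t ≥ 0` (with the right derivative at
`t = 0`), and `x = φ` on `[-τ_max, 0]`. -/
structure IsSolution {n : ℕ} (f g : (Fin n → ℝ) → (Fin n → ℝ)) (τ : ℝ → ℝ)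
    (φ x : ℝ → Fin n → ℝ) : Prop where
  initial : ∀ s ∈ Icc (-maxDelay τ) 0, x s = φ s
  deriv : ∀ t, 0 ≤ t → HasDerivWithinAt x (f (x t) + g (x (t - τ t))) (Ici 0) t

/-- Global asymptotic stability of the origin with respect to nonnegative initial conditions:
every nonnegative initial condition has a solution on `[0, ∞)` (no finite escape time), the origin
is stable, and every solution converges to the origin. -/
structure IsGloballyAsymptoticallyStable {n : ℕ} (f g : (Fin n → ℝ) → (Fin n → ℝ))
    (τ : ℝ → ℝ) : Prop where
  exists_solution : ∀ φ : ℝ → Fin n → ℝ, IsNonnegInitial τ φ → ∃ x, IsSolution f g τ φ x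
  stable : ∀ ε : ℝ, 0 < ε → ∃ δ : ℝ, 0 < δ ∧
    ∀ φ : ℝ → Fin n → ℝ, IsNonnegInitial τ φ → (∀ s ∈ Icc (-maxDelay τ) 0, ‖φ s‖ < δ) →
      ∀ x, IsSolution f g τ φ x → ∀ t, 0 ≤ t → ‖x t‖ < ε
  attractive : ∀ φ : ℝ → Fin n → ℝ, IsNonnegInitial τ φ →
    ∀ x, IsSolution f g τ φ x → Tendsto x atTop (𝓝 0)

/-! Homogeneity turns one vector `v` with `f v + g v < 0` into a curve `dilation r c v`, `c > 0`,
along which `f + g` stays negative; the curve shrinks to the origin and its order boxes exhaust the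
orthant. Each such box is invariant for every delay: on its i-th upper face, quasimonotonicity of
`f` and monotonicity of `g` bound the i-th velocity by its negative value at the corner. Invariance
gives stability. For attractivity, let `l` be the infimum of the scales whose boxes eventually
contain the solution. If `l > 0`, then once the delayed time is also late, an affine barrier moves
the solution from the box slightly above `l` to one slightly below it, a contradiction
(`IsSolution.eventually_le_of_le_dilation`).

Two points need care because the fields need not be Lipschitz at the origin. Solutions must be shown
to stay nonnegative: `IsSolution.nonneg_step` bounds the negative part relative to the running
homogeneous norm and improves the bound by iteration. Existence comes from monotone iteration: on a
box, `f + c • id` is monotone for some `c` (`exists_shift_monotone`), so the variation-of-constants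
operator preserves order, and iterating it downwards from the top corner converges to a solution.

Conversely, suppose the undelayed system is attractive. A nonzero `y ≥ 0` with `f y + g y ≥ 0` would
keep its solution above `y` (`le_of_subequilibrium`), so there is none. A maximization argument
(`exists_pos_apply_neg`) then produces `v`. -/

section

/-! ### Real induction and one-sided differential inequalities -/

/-- Real induction on a compact interval, with access to the whole past. -/
theorem forall_mem_Icc_of_step {P : ℝ → Prop} {a b : ℝ}
    (hclosed : IsClosed (Icc a b ∩ {t | P t})) (ha : P a)
    (hstep : ∀ t ∈ Ico a b, (∀ s ∈ Icc a t, P s) → ∃ t' > t, ∀ s ∈ Ioc t t', P s) :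
    ∀ t ∈ Icc a b, P t := by
  intro t₁ ht₁
  have hab : a ≤ b := ht₁.1.trans ht₁.2
  set S : Set ℝ := {t | t ∈ Icc a b ∧ ∀ s ∈ Icc a t, P s} with hS
  have haS : a ∈ S := ⟨left_mem_Icc.2 hab, fun s hs => by
    rw [le_antisymm hs.2 hs.1]; exact ha⟩
  have hbdd : BddAbove S := ⟨b, fun t ht => ht.1.2⟩
  set c := sSup S with hc
  have hac : a ≤ c := le_csSup hbdd haS
  have hcb : c ≤ b := csSup_le ⟨a, haS⟩ fun t ht => ht.1.2
  have hlt : ∀ s ∈ Ico a c, P s := fun s hs => by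
    obtain ⟨t, ht, hst⟩ := exists_lt_of_lt_csSup ⟨a, haS⟩ hs.2
    exact ht.2 s ⟨hs.1, hst.le⟩
  have hPc : P c := by
    rcases hac.eq_or_lt with h | h
    · rw [← h]; exact ha
    · have hsub : Ico a c ⊆ Icc a b ∩ {t | P t} := fun s hs =>
        ⟨⟨hs.1, hs.2.le.trans hcb⟩, hlt s hs⟩
      have hcl := closure_minimal hsub hclosed
      rw [closure_Ico h.ne] at hcl
      exact (hcl (right_mem_Icc.2 hac)).2
  have hcS : ∀ s ∈ Icc a c, P s := fun s hs => by
    rcases hs.2.eq_or_lt with h | h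
    · rw [h]; exact hPc
    · exact hlt s ⟨hs.1, h⟩
  rcases hcb.eq_or_lt with h | h
  · exact hcS t₁ ⟨ht₁.1, h ▸ ht₁.2⟩
  · obtain ⟨t', ht', hP⟩ := hstep c ⟨hac, h⟩ hcS
    have hmem : min t' b ∈ S := by
      refine ⟨⟨hac.trans (le_min ht'.le hcb), min_le_right _ _⟩, fun s hs => ?_⟩
      rcases le_or_gt s c with hsc | hsc
      · exact hcS s ⟨hs.1, hsc⟩
      · exact hP s ⟨hsc, hs.2.trans (min_le_left _ _)⟩
    exact absurd (le_csSup hbdd hmem) (not_le.2 (lt_min ht' h))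

/-- A function whose right derivative is at least `-B` wherever the function is nonpositive
decreases below zero at rate at most `B`. -/
theorem neg_mul_sub_le_of_deriv_right {y y' : ℝ → ℝ} {a b B : ℝ} (hB : 0 ≤ B)
    (hcont : ContinuousOn y (Icc a b))
    (hderiv : ∀ t ∈ Ico a b, HasDerivWithinAt y (y' t) (Ici t) t) (ha : 0 ≤ y a)
    (hbound : ∀ t ∈ Ico a b, y t ≤ 0 → -B ≤ y' t) :
    ∀ t ∈ Icc a b, -(B * (t - a)) ≤ y t := by
  intro t ht
  -- The slack `ε` makes the slope comparison strict at a contact point; there `y = -((B + ε) * (s -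
  -- a)) ≤ 0`, so `hbound` applies.
  have key : ∀ ε > 0, -y t ≤ (B + ε) * (t - a) := by
    intro ε hε
    refine image_le_of_deriv_right_lt_deriv_boundary' (f := fun t => -y t)
      (f' := fun t => -y' t) (a := a) (b := b) (B := fun t => (B + ε) * (t - a))
      (B' := fun _ => B + ε) hcont.neg (fun s hs => (hderiv s hs).neg) (by simpa using ha)
      (by fun_prop) (fun s hs => ?_) (fun s hs h => ?_) ht
    · simpa using (((hasDerivAt_id s).sub_const a).const_mul (B + ε)).hasDerivWithinAt
    · have h1 : 0 ≤ (B + ε) * (s - a) := mul_nonneg (by linarith) (by linarith [hs.1])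
      have h2 := hbound s hs (by linarith)
      linarith
  have : -y t ≤ B * (t - a) := by
    refine le_of_forall_pos_le_add fun ε hε => ?_
    have hpos : 0 < t - a + 1 := by linarith [ht.1]
    refine (key (ε / (t - a + 1)) (by positivity)).trans ?_
    rw [add_mul]
    have : ε / (t - a + 1) * (t - a) ≤ ε / (t - a + 1) * (t - a + 1) := by
      gcongr; linarith
    rw [div_mul_cancel₀ _ hpos.ne'] at this
    linarith
  linarith

variable {n : ℕ}

/-- Along the segment from `x` to `y` the i-th coordinate is constant, so only off-diagonal partial
derivatives enter. The open segment avoids the origin, where `f` may fail to be differentiable,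
because `γ s ≥ s • y`; continuity suffices at the endpoints. -/
theorem le_of_nonneg_of_eq_coord {f : (Fin n → ℝ) → (Fin n → ℝ)} (hf : IsCooperative f)
    {x y : Fin n → ℝ} {i : Fin n} (hx : 0 ≤ x) (hxy : x ≤ y) (hi : x i = y i) :
    f x i ≤ f y i := by
  by_cases hy : y = 0
  · have : x = y := le_antisymm hxy (hy ▸ hx)
    rw [this]
  set γ : ℝ → Fin n → ℝ := fun s => x + s • (y - x) with hγ
  have hγne : ∀ s ∈ Ioo (0 : ℝ) 1, 0 ≤ γ s ∧ γ s ≠ 0 := by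
    intro s hs
    have hle : s • y ≤ γ s := fun k => by
      simp only [hγ, Pi.add_apply, Pi.smul_apply, Pi.sub_apply, smul_eq_mul]
      nlinarith [hx k, hs.2, show (0 : ℝ) ≤ x k from hx k]
    have h0 : 0 ≤ s • y := smul_nonneg hs.1.le (hx.trans hxy)
    refine ⟨h0.trans hle, fun h => hy ?_⟩
    have : s • y = 0 := le_antisymm (h ▸ hle) h0
    exact (smul_eq_zero.1 this).resolve_left hs.1.ne'
  have hγd : ∀ s, HasDerivAt γ (y - x) s := fun s => by
    simpa only [one_smul, id] using ((hasDerivAt_id s).smul_const (y - x)).const_add x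
  have hd : ∀ s ∈ Ioo (0 : ℝ) 1,
      HasDerivAt (fun s => f (γ s) i) (fderiv ℝ f (γ s) (y - x) i) s := by
    intro s hs
    have h1 : DifferentiableAt ℝ f (γ s) :=
      ((hf.contDiffOn.contDiffAt (isOpen_compl_singleton.mem_nhds (hγne s hs).2)).differentiableAt
        (by simp))
    exact hasDerivAt_pi.1 (h1.hasFDerivAt.comp_hasDerivAt s (hγd s)) i
  have hmono : MonotoneOn (fun s => f (γ s) i) (Icc 0 1) := by
    refine monotoneOn_of_deriv_nonneg (convex_Icc 0 1) ?_ ?_ ?_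
    · refine Continuous.continuousOn ?_
      have := hf.continuous
      have hγc : Continuous γ := continuous_iff_continuousAt.2 fun s => (hγd s).continuousAt
      exact (continuous_apply i).comp (this.comp hγc)
    · rw [interior_Icc]
      exact fun s hs => (hd s hs).differentiableAt.differentiableWithinAt
    · rw [interior_Icc]
      intro s hs
      rw [(hd s hs).deriv, pi_eq_sum_univ' (y - x), map_sum, Finset.sum_apply]
      refine Finset.sum_nonneg fun j _ => ?_
      rw [map_smul, Pi.smul_apply, smul_eq_mul]
      by_cases hij : i = j
      · subst hij; simp [hi]
      · have h2 := hf.metzler (γ s) (hγne s hs).1 (hγne s hs).2 i j hij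
        exact mul_nonneg (sub_nonneg.2 (hxy j)) h2
  have := hmono (left_mem_Icc.2 zero_le_one) (right_mem_Icc.2 zero_le_one) zero_le_one
  simpa [hγ] using this

/-! ### Homogeneous norm and scale-invariant estimates -/

/-- The homogeneous norm `max_j |z_j| ^ (1 / r_j)`. -/
noncomputable def homNorm (r : Fin n → ℝ) (z : Fin n → ℝ) : ℝ :=
  ‖fun j => |z j| ^ (r j)⁻¹‖

theorem homNorm_nonneg (r z : Fin n → ℝ) : 0 ≤ homNorm r z := norm_nonneg _

theorem homNorm_le_iff {r : Fin n → ℝ} (hr : ∀ i, 0 < r i) {z : Fin n → ℝ} {m : ℝ} (hm : 0 ≤ m) :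
    homNorm r z ≤ m ↔ ∀ j, |z j| ≤ m ^ r j := by
  rw [homNorm, pi_norm_le_iff_of_nonneg hm]
  refine forall_congr' fun j => ?_
  rw [Real.norm_of_nonneg (Real.rpow_nonneg (abs_nonneg _) _),
    Real.rpow_inv_le_iff_of_pos (abs_nonneg _) hm (hr j)]

theorem abs_le_homNorm_rpow {r : Fin n → ℝ} (hr : ∀ i, 0 < r i) (z : Fin n → ℝ) (j : Fin n) :
    |z j| ≤ homNorm r z ^ r j :=
  (homNorm_le_iff hr (homNorm_nonneg r z)).1 le_rfl j

theorem exists_abs_eq_homNorm_rpow {r : Fin n → ℝ} (hr : ∀ i, 0 < r i) {z : Fin n → ℝ}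
    (hz : 0 < homNorm r z) : ∃ j, |z j| = homNorm r z ^ r j := by
  have : Nonempty (Fin n) := by
    by_contra h
    rw [not_nonempty_iff] at h
    have : homNorm r z ≤ 0 := (homNorm_le_iff hr le_rfl).2 fun j => h.elim j
    linarith
  obtain ⟨j, hj⟩ := Finite.exists_max fun j => |z j| ^ (r j)⁻¹
  refine ⟨j, ?_⟩
  have h0 : 0 ≤ |z j| ^ (r j)⁻¹ := Real.rpow_nonneg (abs_nonneg _) _
  have h1 : homNorm r z ≤ |z j| ^ (r j)⁻¹ := by
    rw [homNorm, pi_norm_le_iff_of_nonneg h0]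
    intro k
    rw [Real.norm_of_nonneg (Real.rpow_nonneg (abs_nonneg _) _)]
    exact hj k
  refine le_antisymm (abs_le_homNorm_rpow hr z j) ?_
  rwa [Real.le_rpow_inv_iff_of_pos hz.le (abs_nonneg _) (hr j)] at h1

theorem continuous_homNorm {r : Fin n → ℝ} (hr : ∀ i, 0 < r i) : Continuous (homNorm r) := by
  unfold homNorm
  refine continuous_norm.comp (continuous_pi fun j => ?_)
  exact ((continuous_apply j).abs).rpow_const fun _ => Or.inr (inv_pos.2 (hr j)).le

theorem eq_zero_of_abs_le_zero_rpow {r : Fin n → ℝ} (hr : ∀ i, 0 < r i) {z : Fin n → ℝ}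
    (hz : ∀ j, |z j| ≤ (0 : ℝ) ^ r j) : z = 0 := by
  ext j
  have := hz j
  rw [Real.zero_rpow (hr j).ne'] at this
  exact abs_nonpos_iff.1 this

theorem dilation_dilation_inv {r : Fin n → ℝ} {m : ℝ} (hm : 0 < m) (z : Fin n → ℝ) :
    dilation r m (fun j => z j / m ^ r j) = z := by
  ext j
  have : m ^ r j ≠ 0 := (Real.rpow_pos_of_pos hm _).ne'
  simp only [dilation]
  field_simp

theorem IsHomogeneousField.apply_eq {f : (Fin n → ℝ) → (Fin n → ℝ)} {r : Fin n → ℝ} {p : ℝ}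
    (hf : IsHomogeneousField r p f) {m : ℝ} (hm : 0 < m) (z : Fin n → ℝ) (i : Fin n) :
    f z i = m ^ (p + r i) * f (fun j => z j / m ^ r j) i := by
  have h := congrFun (hf (fun j => z j / m ^ r j) m hm) i
  rw [dilation_dilation_inv hm] at h
  rw [h, Pi.smul_apply, smul_eq_mul, dilation, Real.rpow_add hm, mul_assoc]

/-- Growth of a homogeneous field. -/
theorem exists_homogeneous_bound {f : (Fin n → ℝ) → (Fin n → ℝ)} {r : Fin n → ℝ} {p : ℝ}
    (hr : ∀ i, 0 < r i) (hf : IsRegularField f) (hom : IsHomogeneousField r p f) :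
    ∃ C : ℝ, 0 ≤ C ∧ ∀ (z : Fin n → ℝ) (m : ℝ), 0 ≤ m → (∀ j, |z j| ≤ m ^ r j) →
      ∀ i, |f z i| ≤ C * m ^ (p + r i) := by
  obtain ⟨C, hC⟩ := (isCompact_closedBall (0 : Fin n → ℝ) 1).exists_bound_of_continuousOn
    hf.continuous.continuousOn
  refine ⟨max C 0, le_max_right _ _, fun z m hm hz i => ?_⟩
  rcases hm.eq_or_lt with rfl | hm
  · rw [eq_zero_of_abs_le_zero_rpow hr hz, hf.map_zero, Pi.zero_apply, abs_zero]
    exact mul_nonneg (le_max_right _ _) (Real.rpow_nonneg le_rfl _)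
  · rw [hom.apply_eq hm, abs_mul, abs_of_pos (Real.rpow_pos_of_pos hm _), mul_comm]
    gcongr
    have h1 : (fun j => z j / m ^ r j) ∈ Metric.closedBall (0 : Fin n → ℝ) 1 := by
      rw [mem_closedBall_zero_iff, pi_norm_le_iff_of_nonneg zero_le_one]
      intro j
      have := Real.rpow_pos_of_pos hm (r j)
      rw [Real.norm_eq_abs, abs_div, abs_of_pos this, div_le_one this]
      exact hz j
    exact ((norm_le_pi_norm _ i).trans (hC _ h1)).trans (le_max_left _ _)

/-- Scale-invariant Lipschitz estimate for a homogeneous field, away from the origin. -/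
theorem exists_homogeneous_lipschitz {f : (Fin n → ℝ) → (Fin n → ℝ)} {r : Fin n → ℝ} {p : ℝ}
    (hf : IsRegularField f) (hom : IsHomogeneousField r p f) :
    ∃ L : ℝ, 0 ≤ L ∧ ∀ (x y : Fin n → ℝ) (m κ : ℝ) (j : Fin n), 0 < m → 0 ≤ κ →
      (∀ k, |x k| ≤ m ^ r k) → (∀ k, |y k| ≤ m ^ r k) →
      m ^ r j / 2 ≤ x j → m ^ r j / 2 ≤ y j → (∀ k, |x k - y k| ≤ κ * m ^ r k) →
      ∀ i, |f x i - f y i| ≤ L * κ * m ^ (p + r i) := by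
  -- Cutting the unit ball by `z j ≥ 1 / 2` leaves a compact convex set away from the origin, where
  -- a C¹ field is Lipschitz. Dilation by `m` carries the estimate to every scale, and the sum of
  -- the `K j` serves all `j` at once.
  have hK : ∀ j : Fin n, ∃ K : NNReal,
      LipschitzOnWith K f (Metric.closedBall 0 1 ∩ {z | 1 / 2 ≤ z j}) := by
    intro j
    have hcl : IsClosed {z : Fin n → ℝ | 1 / 2 ≤ z j} :=
      isClosed_le continuous_const (continuous_apply j)
    have hcv : Convex ℝ {z : Fin n → ℝ | 1 / 2 ≤ z j} :=
      convex_halfSpace_ge (f := fun z : Fin n → ℝ => z j) ⟨fun _ _ => rfl, fun _ _ => rfl⟩ _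
    refine ContDiffOn.exists_lipschitzOnWith (n := 1) (hf.contDiffOn.mono ?_) one_ne_zero
      ((convex_closedBall _ _).inter hcv) ((isCompact_closedBall _ _).inter_right hcl)
    rintro z ⟨-, hz⟩ rfl
    simp only [mem_ofPred_eq, Pi.zero_apply] at hz
    linarith
  choose K hK using hK
  refine ⟨∑ j, (K j : ℝ), Finset.sum_nonneg fun j _ => (K j).2, ?_⟩
  intro x y m κ j hm hκ hx hy hxj hyj hxy i
  have hmem : ∀ z : Fin n → ℝ, (∀ k, |z k| ≤ m ^ r k) → m ^ r j / 2 ≤ z j →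
      (fun k => z k / m ^ r k) ∈ Metric.closedBall (0 : Fin n → ℝ) 1 ∩ {z | 1 / 2 ≤ z j} := by
    intro z hz hzj
    refine ⟨?_, ?_⟩
    · rw [mem_closedBall_zero_iff, pi_norm_le_iff_of_nonneg zero_le_one]
      intro k
      have := Real.rpow_pos_of_pos hm (r k)
      rw [Real.norm_eq_abs, abs_div, abs_of_pos this, div_le_one this]
      exact hz k
    · have := Real.rpow_pos_of_pos hm (r j)
      rw [mem_ofPred_eq, le_div_iff₀ this]
      linarith
  rw [hom.apply_eq hm x, hom.apply_eq hm y, ← mul_sub, abs_mul,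
    abs_of_pos (Real.rpow_pos_of_pos hm _), mul_comm]
  gcongr
  have h1 := (hK j).norm_sub_le (hmem x hx hxj) (hmem y hy hyj)
  have h2 : ‖(fun k => x k / m ^ r k) - (fun k => y k / m ^ r k)‖ ≤ κ := by
    rw [pi_norm_le_iff_of_nonneg hκ]
    intro k
    have := Real.rpow_pos_of_pos hm (r k)
    rw [Pi.sub_apply, ← sub_div, Real.norm_eq_abs, abs_div, abs_of_pos this, div_le_iff₀ this]
    exact hxy k
  have h3 : (K j : ℝ) ≤ ∑ j, (K j : ℝ) :=
    Finset.single_le_sum (f := fun j => (K j : ℝ)) (fun j _ => (K j).2) (Finset.mem_univ j)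
  calc |f (fun k => x k / m ^ r k) i - f (fun k => y k / m ^ r k) i|
      ≤ ‖f (fun k => x k / m ^ r k) - f (fun k => y k / m ^ r k)‖ :=
        norm_le_pi_norm (f (fun k => x k / m ^ r k) - f (fun k => y k / m ^ r k)) i
    _ ≤ K j * κ := h1.trans (by gcongr)
    _ ≤ _ := by gcongr

/-- On a box, a cooperative homogeneous field becomes monotone after adding a multiple of the
identity. -/
theorem exists_shift_monotone {f : (Fin n → ℝ) → (Fin n → ℝ)} {r : Fin n → ℝ} {p : ℝ}
    (hr : ∀ i, 0 < r i) (hp : 0 ≤ p) (hf : IsRegularField f) (hcoop : IsCooperative f)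
    (hom : IsHomogeneousField r p f) (V : Fin n → ℝ) :
    ∃ c : ℝ, 0 ≤ c ∧ ∀ x y : Fin n → ℝ, 0 ≤ x → x ≤ y → y ≤ V →
      ∀ i, f x i + c * x i ≤ f y i + c * y i := by
  obtain ⟨C, hC0, hC⟩ := exists_homogeneous_bound hr hf hom
  obtain ⟨L, hL0, hL⟩ := exists_homogeneous_lipschitz hf hom
  set R := homNorm r V
  have hR : 0 ≤ R := homNorm_nonneg r V
  -- `R` bounds the scale of every point of the box, and `m ^ p ≤ R ^ p` since `p ≥ 0`. `L` pays for
  -- small changes of coordinate `i`, `4 * C` for large ones. The intermediate point `w` is `y` with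
  -- coordinate `i` lowered to `x i`: quasimonotonicity handles `x` to `w`.
  refine ⟨(L + 4 * C) * R ^ p, by positivity, fun x y hx hxy hyV i => ?_⟩
  set w := Function.update y i (x i) with hw
  have hwi : w i = x i := by simp [hw]
  have hwk : ∀ k, k ≠ i → w k = y k := fun k hk => by simp [hw, hk]
  have hxw : x ≤ w := fun k => by
    by_cases hk : k = i
    · subst hk; rw [hwi]
    · rw [hwk k hk]; exact hxy k
  have hwy : w ≤ y := fun k => by
    by_cases hk : k = i
    · subst hk; rw [hwi]; exact hxy k
    · rw [hwk k hk]
  have h1 : f x i ≤ f w i := le_of_nonneg_of_eq_coord hcoop hx hxw hwi.symm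
  suffices h2 : f w i - f y i ≤ (L + 4 * C) * R ^ p * (y i - w i) by
    rw [hwi] at h2; linarith
  have hw0 : ∀ k, 0 ≤ w k := hx.trans hxw
  have hy0 : ∀ k, 0 ≤ y k := hx.trans hxy
  have hd : 0 ≤ y i - w i := sub_nonneg.2 (hwy i)
  set m := homNorm r y with hm
  have hm0 : 0 ≤ m := homNorm_nonneg r y
  have hym : ∀ k, |y k| ≤ m ^ r k := abs_le_homNorm_rpow hr y
  have hwm : ∀ k, |w k| ≤ m ^ r k := fun k => by
    rw [abs_of_nonneg (hw0 k)]
    exact (hwy k).trans ((le_abs_self _).trans (hym k))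
  have hmR : m ≤ R := by
    rw [homNorm_le_iff hr hR]
    intro k
    rw [abs_of_nonneg (hy0 k)]
    exact (hyV k).trans ((le_abs_self _).trans (abs_le_homNorm_rpow hr V k))
  rcases hm0.eq_or_lt with h0 | hmpos
  · rw [← h0] at hym hwm
    rw [eq_zero_of_abs_le_zero_rpow hr hym, eq_zero_of_abs_le_zero_rpow hr hwm]
    simp
  have hmi := Real.rpow_pos_of_pos hmpos (r i)
  have hmp := Real.rpow_nonneg hm0 p
  have hpow : m ^ (p + r i) = m ^ p * m ^ r i := Real.rpow_add hmpos _ _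
  have hfin : ∀ D : ℝ, 0 ≤ D → D ≤ L + 4 * C →
      D * m ^ p * (y i - w i) ≤ (L + 4 * C) * R ^ p * (y i - w i) := by
    intro D hD hD'
    gcongr
  obtain ⟨j, hj⟩ := exists_abs_eq_homNorm_rpow hr hmpos
  rw [abs_of_nonneg (hy0 j), ← hm] at hj
  have hmj := Real.rpow_pos_of_pos hmpos (r j)
  by_cases hcase : m ^ r j / 2 ≤ w j
  · have := hL w y m ((y i - w i) / m ^ r i) j hmpos (by positivity) hwm hym hcase
      (by linarith) (fun k => by
        by_cases hk : k = i
        · subst hk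
          rw [div_mul_cancel₀ _ hmi.ne', abs_sub_comm, abs_of_nonneg hd]
        · rw [hwk k hk, sub_self, abs_zero]
          have := Real.rpow_pos_of_pos hmpos (r k)
          positivity) i
    have h3 : L * ((y i - w i) / m ^ r i) * m ^ (p + r i) = L * m ^ p * (y i - w i) := by
      rw [hpow]; field_simp
    rw [h3] at this
    exact ((le_abs_self _).trans this).trans (hfin L hL0 (by linarith))
  -- The dominant coordinate of `y` dropped below half its size, so it is the altered one. Then `m ^
  -- r i ≤ 2 * (y i - w i)`, and the growth bound alone suffices.
  · have hji : j = i := by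
      by_contra h
      rw [hwk j h, hj] at hcase
      exact hcase (by linarith)
    subst hji
    have h3 := hC w m hm0 hwm j
    have h4 := hC y m hm0 hym j
    have h5 : f w j - f y j ≤ 2 * C * m ^ (p + r j) := by
      have := abs_le.1 h3; have := abs_le.1 h4; linarith
    refine h5.trans (le_trans ?_ (hfin (4 * C) (by positivity) (by linarith)))
    rw [hpow]
    have h6 : m ^ r j ≤ 2 * (y j - w j) := by push Not at hcase; linarith
    calc 2 * C * (m ^ p * m ^ r j) ≤ 2 * C * (m ^ p * (2 * (y j - w j))) := by gcongr
      _ = _ := by ring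

/-! ### Admissible delays and elementary properties of solutions -/

theorem IsAdmissibleDelay.bddBelow {τ : ℝ → ℝ} (hτ : IsAdmissibleDelay τ) :
    BddBelow ((fun t => t - τ t) '' Ici 0) := by
  obtain ⟨T, hT⟩ := eventually_atTop.1 (hτ.tendsto.eventually_ge_atTop 0)
  have hc : ContinuousOn (fun t => t - τ t) (Icc 0 T) :=
    continuousOn_id.sub (hτ.continuousOn.mono Icc_subset_Ici_self)
  obtain ⟨m, hm⟩ := isCompact_Icc.bddBelow_image hc
  refine ⟨min m 0, ?_⟩
  rintro _ ⟨t, ht, rfl⟩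
  rcases le_total t T with h | h
  · exact (min_le_left _ _).trans (hm ⟨t, ⟨ht, h⟩, rfl⟩)
  · exact (min_le_right _ _).trans (hT t h)

theorem IsAdmissibleDelay.neg_maxDelay_le {τ : ℝ → ℝ} (hτ : IsAdmissibleDelay τ) {t : ℝ}
    (ht : 0 ≤ t) : -maxDelay τ ≤ t - τ t := by
  rw [maxDelay, neg_neg]
  exact csInf_le hτ.bddBelow ⟨t, ht, rfl⟩

theorem IsAdmissibleDelay.maxDelay_nonneg {τ : ℝ → ℝ} (hτ : IsAdmissibleDelay τ) :
    0 ≤ maxDelay τ := by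
  have h1 := hτ.neg_maxDelay_le le_rfl
  have h2 := hτ.nonneg 0 le_rfl
  linarith

theorem isAdmissibleDelay_zero : IsAdmissibleDelay (fun _ => 0) where
  continuousOn := continuousOn_const
  nonneg _ _ := le_rfl
  tendsto := by simp only [sub_zero]; exact tendsto_id

theorem IsSolution.continuousOn {f g : (Fin n → ℝ) → (Fin n → ℝ)} {τ : ℝ → ℝ}
    {φ x : ℝ → Fin n → ℝ} (hx : IsSolution f g τ φ x) : ContinuousOn x (Ici 0) :=
  fun t ht => (hx.deriv t ht).continuousWithinAt

theorem IsSolution.deriv_coord {f g : (Fin n → ℝ) → (Fin n → ℝ)} {τ : ℝ → ℝ}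
    {φ x : ℝ → Fin n → ℝ} (hx : IsSolution f g τ φ x) {t : ℝ} (ht : 0 ≤ t) (i : Fin n) :
    HasDerivWithinAt (fun s => x s i) (f (x t) i + g (x (t - τ t)) i) (Ici t) t :=
  (hasDerivWithinAt_pi.1 (hx.deriv t ht) i).mono (Ici_subset_Ici.2 ht)

theorem IsSolution.continuousOn_coord {f g : (Fin n → ℝ) → (Fin n → ℝ)} {τ : ℝ → ℝ}
    {φ x : ℝ → Fin n → ℝ} (hx : IsSolution f g τ φ x) (i : Fin n) {s : Set ℝ} (hs : s ⊆ Ici 0) :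
    ContinuousOn (fun s => x s i) s :=
  (continuous_apply i).comp_continuousOn (hx.continuousOn.mono hs)

theorem IsNondecreasingField.nonneg {g : (Fin n → ℝ) → (Fin n → ℝ)} (hg : IsNondecreasingField g)
    (hg0 : g 0 = 0) {x : Fin n → ℝ} (hx : 0 ≤ x) : 0 ≤ g x := by
  simpa [hg0] using hg x 0 le_rfl hx

/-- A field that is nonnegative in a coordinate at the positive part of `x` is nearly so at `x`. -/
theorem neg_le_of_posPart_nonneg {f : (Fin n → ℝ) → (Fin n → ℝ)} {r : Fin n → ℝ} {p L : ℝ}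
    (hL : ∀ (x y : Fin n → ℝ) (m κ : ℝ) (j : Fin n), 0 < m → 0 ≤ κ →
      (∀ k, |x k| ≤ m ^ r k) → (∀ k, |y k| ≤ m ^ r k) →
      m ^ r j / 2 ≤ x j → m ^ r j / 2 ≤ y j → (∀ k, |x k - y k| ≤ κ * m ^ r k) →
      ∀ i, |f x i - f y i| ≤ L * κ * m ^ (p + r i))
    {x : Fin n → ℝ} {m κ : ℝ} {i j : Fin n} (hm : 0 < m) (hκ : 0 ≤ κ)
    (hxm : ∀ k, |x k| ≤ m ^ r k) (hj : m ^ r j / 2 ≤ x j) (hneg : ∀ k, -x k ≤ κ * m ^ r k)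
    (hpos : 0 ≤ f (x ⊔ 0) i) : -(L * κ * m ^ (p + r i)) ≤ f x i := by
  have hmj := Real.rpow_pos_of_pos hm (r j)
  have h := hL x (x ⊔ 0) m κ j hm hκ hxm (fun k => by
      rw [Pi.sup_apply, Pi.zero_apply, abs_of_nonneg le_sup_right]
      exact sup_le ((le_abs_self _).trans (hxm k)) (Real.rpow_nonneg hm.le _)) hj
    (hj.trans (le_sup_left (a := x j))) (fun k => by
      have hmk := Real.rpow_pos_of_pos hm (r k)
      rw [Pi.sup_apply, Pi.zero_apply]
      rcases le_total 0 (x k) with h0 | h0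
      · rw [sup_of_le_left h0, sub_self, abs_zero]; positivity
      · rw [sup_of_le_right h0, sub_zero, abs_of_nonpos h0]; exact hneg k) i
  linarith [(abs_le.1 h).1]

/-! ### Invariance of the nonnegative orthant -/

section Nonneg

variable {f g : (Fin n → ℝ) → (Fin n → ℝ)} {r : Fin n → ℝ} {p : ℝ} {τ : ℝ → ℝ}
  {φ x : ℝ → Fin n → ℝ}

/-- The fields may fail to be Lipschitz at 0, and cooperativity is known only on the orthant, so `x`
is compared with its positive part `x ⊔ 0` at the scale of the running maximum `M` of the
homogeneous norm. On a short window some coordinate stays of size `M`, which keeps the scaled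
Lipschitz estimate available. -/
theorem IsSolution.nonneg_step (hr : ∀ i, 0 < r i) (hp : 0 ≤ p)
    (hf : IsRegularField f) (hg : IsRegularField g)
    (hf_coop : IsCooperative f) (hg_mono : IsNondecreasingField g)
    (hf_hom : IsHomogeneousField r p f) (hg_hom : IsHomogeneousField r p g)
    (hτ : IsAdmissibleDelay τ) (hx : IsSolution f g τ φ x) {t₀ : ℝ} (ht₀ : 0 ≤ t₀)
    (hpast : ∀ s ∈ Icc (-maxDelay τ) t₀, 0 ≤ x s) :
    ∃ t' > t₀, ∀ s ∈ Ioc t₀ t', 0 ≤ x s := by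
  obtain ⟨Cf, hCf0, hCf⟩ := exists_homogeneous_bound hr hf hf_hom
  obtain ⟨Cg, hCg0, hCg⟩ := exists_homogeneous_bound hr hg hg_hom
  obtain ⟨Lf, hLf0, hLf⟩ := exists_homogeneous_lipschitz hf hf_hom
  obtain ⟨Lg, hLg0, hLg⟩ := exists_homogeneous_lipschitz hg hg_hom
  have hxc : ContinuousOn (fun s => homNorm r (x s)) (Icc t₀ (t₀ + 1)) :=
    (continuous_homNorm hr).comp_continuousOn
      (hx.continuousOn.mono fun s hs => ht₀.trans hs.1)
  obtain ⟨R, hR⟩ := isCompact_Icc.exists_bound_of_continuousOn hxc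
  have hR0 : 0 ≤ R := (norm_nonneg _).trans (hR t₀ (left_mem_Icc.2 (by linarith)))
  set D := Cf + Cg + Lf + Lg + 1 with hD
  set Q := R ^ p + 1 with hQ
  have hRp : 0 ≤ R ^ p := Real.rpow_nonneg hR0 p
  -- Chosen so that velocities of size `D * M ^ (p + r i)` move coordinate `i` by at most `M ^ r i /
  -- 4`; `T ≤ 1` keeps the window where `R` bounds the norm.
  set T := (4 * D * Q)⁻¹ with hT
  have hDQ : 1 ≤ D * Q := by nlinarith [mul_nonneg (show 0 ≤ Cf + Cg + Lf + Lg by positivity) hRp]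
  have hTpos : 0 < T := by positivity
  have hT1 : T ≤ 1 := inv_le_one_of_one_le₀ (by linarith)
  have hTD : D * R ^ p * T ≤ 1 / 4 := by
    have h1 : D * Q * T = 1 / 4 := by
      rw [hT]
      have : D * Q ≠ 0 := by positivity
      field_simp
      exact div_self this
    have h2 : D * R ^ p * T ≤ D * Q * T := by gcongr; linarith
    linarith
  set b := t₀ + T with hb
  have hcpt : ∀ t ∈ Icc t₀ b, ContinuousOn (fun s => homNorm r (x s)) (Icc t₀ t) := fun t ht =>
    hxc.mono (Icc_subset_Icc_right (by linarith [ht.2]))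
  set M : ℝ → ℝ := fun t => sSup ((fun s => homNorm r (x s)) '' Icc t₀ t) with hM
  have hM1 : ∀ t ∈ Icc t₀ b, ∀ s ∈ Icc t₀ t, homNorm r (x s) ≤ M t := fun t ht s hs =>
    le_csSup (isCompact_Icc.bddAbove_image (hcpt t ht)) ⟨s, hs, rfl⟩
  have hM2 : ∀ t ∈ Icc t₀ b, ∃ s ∈ Icc t₀ t, M t = homNorm r (x s) := fun t ht =>
    isCompact_Icc.exists_sSup_image_eq (nonempty_Icc.2 ht.1) (hcpt t ht)
  have hM0 : ∀ t ∈ Icc t₀ b, 0 ≤ M t := fun t ht =>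
    (homNorm_nonneg r _).trans (hM1 t ht t (right_mem_Icc.2 ht.1))
  have hMR : ∀ t ∈ Icc t₀ b, M t ≤ R := fun t ht => by
    obtain ⟨s, hs, h⟩ := hM2 t ht
    rw [h]
    exact (le_abs_self _).trans (hR s ⟨hs.1, hs.2.trans (by linarith [ht.2])⟩)
  have hMmono : ∀ s t, t₀ ≤ s → s ≤ t → t ≤ b → M s ≤ M t := fun s t hs hst ht => by
    obtain ⟨u, hu, h⟩ := hM2 s ⟨hs, hst.trans ht⟩
    rw [h]
    exact hM1 t ⟨hs.trans hst, ht⟩ u ⟨hu.1, hu.2.trans hst⟩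
  have hxM : ∀ t ∈ Icc t₀ b, ∀ s ∈ Icc t₀ t, ∀ k, |x s k| ≤ M t ^ r k := fun t ht s hs =>
    (homNorm_le_iff hr (hM0 t ht)).1 (hM1 t ht s hs)
  have hpowM : ∀ t ∈ Icc t₀ b, ∀ i, D * M t ^ (p + r i) * T ≤ 1 / 4 * M t ^ r i := by
    intro t ht i
    rw [Real.rpow_add_of_nonneg (hM0 t ht) hp (hr i).le]
    have h1 : M t ^ p ≤ R ^ p := Real.rpow_le_rpow (hM0 t ht) (hMR t ht) hp
    have h2 := Real.rpow_nonneg (hM0 t ht) (r i)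
    have hD0 : 0 ≤ D := by positivity
    calc D * (M t ^ p * M t ^ r i) * T = D * M t ^ p * T * M t ^ r i := by ring
      _ ≤ D * R ^ p * T * M t ^ r i := by gcongr
      _ ≤ _ := by gcongr
  have hdelay : ∀ t ∈ Icc t₀ b, 0 ≤ x (t - τ t) ∨ t - τ t ∈ Icc t₀ t := by
    intro t ht
    have h0 : 0 ≤ t := ht₀.trans ht.1
    rcases le_total (t - τ t) t₀ with h | h
    · exact Or.inl (hpast _ ⟨hτ.neg_maxDelay_le h0, h⟩)
    · exact Or.inr ⟨h, by linarith [hτ.nonneg t h0]⟩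
  have hxt₀ : 0 ≤ x t₀ := hpast t₀ ⟨by linarith [hτ.maxDelay_nonneg], le_rfl⟩
  have hlow : ∀ t ∈ Icc t₀ b, ∀ s u, t₀ ≤ s → s ≤ u → u ≤ t → ∀ i,
      x s i - 1 / 4 * M t ^ r i ≤ x u i := by
    intro t ht s u hs hsu hut i
    have hpw := Real.rpow_nonneg (hM0 t ht) (p + r i)
    have h := neg_mul_sub_le_of_deriv_right (y := fun v => x v i - x s i)
      (y' := fun v => f (x v) i + g (x (v - τ v)) i) (a := s) (b := u)
      (B := D * M t ^ (p + r i)) (by positivity)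
      ((hx.continuousOn_coord i fun v hv => (ht₀.trans hs).trans hv.1).sub continuousOn_const)
      (fun v hv => (hx.deriv_coord ((ht₀.trans hs).trans hv.1) i).sub_const _) (by simp)
      (fun v hv _ => by
        have hvt : v ≤ t := hv.2.le.trans hut
        have hv' : v ∈ Icc t₀ b := ⟨hs.trans hv.1, hvt.trans ht.2⟩
        have h1 := (abs_le.1 (hCf (x v) (M t) (hM0 t ht)
          (hxM t ht v ⟨hv'.1, hvt⟩) i)).1
        have h2 : -(Cg * M t ^ (p + r i)) ≤ g (x (v - τ v)) i := by
          rcases hdelay v hv' with h | h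
          · have := hg_mono.nonneg hg.map_zero h i
            have h3 : 0 ≤ Cg * M t ^ (p + r i) := by positivity
            rw [Pi.zero_apply] at this
            linarith
          · exact (abs_le.1 (hCg _ (M t) (hM0 t ht)
              (hxM t ht _ ⟨h.1, h.2.trans hvt⟩) i)).1
        have h3 : 0 ≤ (Lf + Lg + 1) * M t ^ (p + r i) := by positivity
        rw [hD]
        linarith) u (right_mem_Icc.2 hsu)
    have h2 : D * M t ^ (p + r i) * (u - s) ≤ D * M t ^ (p + r i) * T := by
      gcongr; linarith [ht.2]
    have h3 := hpowM t ht i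
    linarith
  -- At the time `s` realizing `M t`, some `|x s j|` equals `M t ^ r j`. Starting from `x t₀ j ≥ 0`,
  -- a drop of at most a quarter rules out the negative sign, and a further quarter leaves at least
  -- half at time `t`.
  have hpos : ∀ t ∈ Icc t₀ b, 0 < M t → ∃ j, M t ^ r j / 2 ≤ x t j := by
    intro t ht hMt
    obtain ⟨s, hs, hMs⟩ := hM2 t ht
    obtain ⟨j, hj⟩ := exists_abs_eq_homNorm_rpow hr (hMs ▸ hMt)
    rw [← hMs] at hj
    have hm := Real.rpow_pos_of_pos hMt (r j)
    have h1 := hlow t ht t₀ s le_rfl hs.1 hs.2 j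
    have h2 := hlow t ht s t hs.1 hs.2 le_rfl j
    have h3 : 0 ≤ x t₀ j := hxt₀ j
    refine ⟨j, ?_⟩
    rcases abs_cases (x s j) with ⟨h4, _⟩ | ⟨h4, _⟩ <;> linarith
  have hzero : ∀ t ∈ Icc t₀ b, M t = 0 → x t = 0 := fun t ht h => by
    have := hxM t ht t (right_mem_Icc.2 ht.1)
    rw [h] at this
    exact eq_zero_of_abs_le_zero_rpow hr this
  -- Bootstrap: if the negative part is at most `κ * M ^ r`, then wherever `x i ≤ 0` the velocity is
  -- at least `-(D * κ * M ^ (p + r i))`. Integrating over the window improves `κ` to at most `κ /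
  -- 2`.
  have hhalf : ∀ k : ℕ, ∀ t ∈ Icc t₀ b, ∀ i, -x t i ≤ (1 / 2) ^ k * M t ^ r i := by
    intro k
    induction k with
    | zero =>
      intro t ht i
      rw [pow_zero, one_mul]
      exact (neg_le_abs _).trans (hxM t ht t (right_mem_Icc.2 ht.1) i)
    | succ k ih =>
      intro t ht i
      have hκ : (0 : ℝ) ≤ (1 / 2) ^ k := by positivity
      have herr : ∀ (F : (Fin n → ℝ) → (Fin n → ℝ)) (L : ℝ), 0 ≤ L → F 0 = 0 →
          (∀ (x y : Fin n → ℝ) (m κ : ℝ) (j : Fin n), 0 < m → 0 ≤ κ →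
            (∀ k, |x k| ≤ m ^ r k) → (∀ k, |y k| ≤ m ^ r k) →
            m ^ r j / 2 ≤ x j → m ^ r j / 2 ≤ y j → (∀ k, |x k - y k| ≤ κ * m ^ r k) →
            ∀ i, |F x i - F y i| ≤ L * κ * m ^ (p + r i)) →
          ∀ s ∈ Icc t₀ t, 0 ≤ F (x s ⊔ 0) i →
            -(L * (1 / 2) ^ k * M t ^ (p + r i)) ≤ F (x s) i := by
        intro F L hL0 hF0 hL s hs hFs
        have hs' : s ∈ Icc t₀ b := ⟨hs.1, hs.2.trans ht.2⟩
        rcases (hM0 s hs').eq_or_lt with h0 | h0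
        · rw [hzero s hs' h0.symm, hF0, Pi.zero_apply, neg_nonpos]
          have := Real.rpow_nonneg (hM0 t ht) (p + r i)
          positivity
        · obtain ⟨j, hj⟩ := hpos s hs' h0
          have h1 := neg_le_of_posPart_nonneg hL h0 hκ (hxM s hs' s (right_mem_Icc.2 hs.1)) hj
            (ih s hs') hFs
          refine le_trans (neg_le_neg ?_) h1
          have h2 := hMmono s t hs.1 hs.2 ht.2
          have h3 : 0 ≤ p + r i := add_nonneg hp (hr i).le
          gcongr
      have hpw := Real.rpow_nonneg (hM0 t ht) (p + r i)
      have h := neg_mul_sub_le_of_deriv_right (y := fun v => x v i)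
        (y' := fun v => f (x v) i + g (x (v - τ v)) i) (a := t₀) (b := t)
        (B := D * (1 / 2) ^ k * M t ^ (p + r i)) (by positivity)
        (hx.continuousOn_coord i fun v hv => ht₀.trans hv.1)
        (fun v hv => hx.deriv_coord (ht₀.trans hv.1) i) (hxt₀ i)
        (fun v hv hvi => by
          have hv' : v ∈ Icc t₀ b := ⟨hv.1, hv.2.le.trans ht.2⟩
          -- Since `x v i ≤ 0`, the positive part vanishes in coordinate `i`, so quasimonotonicity
          -- from the origin gives `0 ≤ f (x v ⊔ 0) i`.
          have h1 := herr f Lf hLf0 hf.map_zero hLf v ⟨hv.1, hv.2.le⟩ (by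
            have := le_of_nonneg_of_eq_coord hf_coop (x := 0) (y := x v ⊔ 0) (i := i) le_rfl
              le_sup_right (by simpa using hvi)
            rwa [hf.map_zero] at this)
          have h2 : -(Lg * (1 / 2) ^ k * M t ^ (p + r i)) ≤ g (x (v - τ v)) i := by
            rcases hdelay v hv' with h | h
            · have := hg_mono.nonneg hg.map_zero h i
              have h3 : 0 ≤ Lg * (1 / 2) ^ k * M t ^ (p + r i) := by positivity
              rw [Pi.zero_apply] at this
              linarith
            · exact herr g Lg hLg0 hg.map_zero hLg _ ⟨h.1, h.2.trans hv.2.le⟩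
                (hg_mono.nonneg hg.map_zero le_sup_right i)
          have h3 : 0 ≤ (Cf + Cg + 1) * (1 / 2) ^ k * M t ^ (p + r i) := by positivity
          rw [hD]
          linarith) t (right_mem_Icc.2 ht.1)
      have h2 : D * (1 / 2) ^ k * M t ^ (p + r i) * (t - t₀)
          ≤ D * (1 / 2) ^ k * M t ^ (p + r i) * T := by
        gcongr; linarith [ht.2]
      have h3 := mul_le_mul_of_nonneg_left (hpowM t ht i) hκ
      have h4 : 0 ≤ (1 / 2) ^ k * M t ^ r i :=
        mul_nonneg hκ (Real.rpow_nonneg (hM0 t ht) _)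
      rw [pow_succ]
      linarith
  refine ⟨b, by linarith, fun t ht i => ?_⟩
  have ht' : t ∈ Icc t₀ b := ⟨ht.1.le, ht.2⟩
  have hlim : Tendsto (fun k : ℕ => (1 / 2 : ℝ) ^ k * M t ^ r i) atTop (𝓝 (0 * M t ^ r i)) :=
    (tendsto_pow_atTop_nhds_zero_of_lt_one (by norm_num) (by norm_num)).mul_const _
  have := ge_of_tendsto' hlim fun k => hhalf k t ht' i
  rw [zero_mul] at this
  rw [Pi.zero_apply]
  linarith

theorem IsSolution.nonneg (hr : ∀ i, 0 < r i) (hp : 0 ≤ p)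
    (hf : IsRegularField f) (hg : IsRegularField g)
    (hf_coop : IsCooperative f) (hg_mono : IsNondecreasingField g)
    (hf_hom : IsHomogeneousField r p f) (hg_hom : IsHomogeneousField r p g)
    (hτ : IsAdmissibleDelay τ) (hφ : IsNonnegInitial τ φ) (hx : IsSolution f g τ φ x) {t : ℝ}
    (ht : -maxDelay τ ≤ t) : 0 ≤ x t := by
  have hinit : ∀ s ∈ Icc (-maxDelay τ) 0, 0 ≤ x s := fun s hs => by
    rw [hx.initial s hs]; exact hφ.nonneg s hs
  rcases le_total t 0 with h0 | h0
  · exact hinit t ⟨ht, h0⟩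
  refine forall_mem_Icc_of_step (P := fun t => 0 ≤ x t) (a := 0) (b := t) ?_
    (hinit 0 ⟨by linarith [hτ.maxDelay_nonneg], le_rfl⟩) ?_ t (right_mem_Icc.2 h0)
  · exact (hx.continuousOn.mono Icc_subset_Ici_self).preimage_isClosed_of_isClosed isClosed_Icc
      isClosed_Ici
  · intro s hs hpast
    refine hx.nonneg_step hr hp hf hg hf_coop hg_mono hf_hom hg_hom hτ hs.1 fun u hu => ?_
    rcases le_total u 0 with h | h
    · exact hinit u ⟨hu.1, h⟩
    · exact hpast u ⟨h, hu.2⟩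

end Nonneg

/-! ### Barriers and dilated boxes -/

/-- A curve stays in the nonnegative orthant if its components have positive derivative whenever
they vanish. -/
theorem nonneg_of_deriv_right_pos {u u' : ℝ → Fin n → ℝ} {a b : ℝ}
    (hcont : ContinuousOn u (Icc a b))
    (hderiv : ∀ t ∈ Ico a b, ∀ i, HasDerivWithinAt (fun s => u s i) (u' t i) (Ici t) t)
    (ha : 0 ≤ u a)
    (hb : ∀ t ∈ Ico a b, (∀ s ∈ Icc a t, 0 ≤ u s) → ∀ i, u t i = 0 → 0 < u' t i) :
    ∀ t ∈ Icc a b, 0 ≤ u t := by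
  refine forall_mem_Icc_of_step
    (hcont.preimage_isClosed_of_isClosed isClosed_Icc isClosed_Ici) ha fun t ht hpast => ?_
  have hut : 0 ≤ u t := hpast t (right_mem_Icc.2 ht.1)
  have hev : ∀ᶠ s in 𝓝[>] t, ∀ i, 0 ≤ u s i := by
    refine eventually_all.2 fun i => ?_
    rcases (show (0 : ℝ) ≤ u t i from hut i).eq_or_lt with h | h
    · have h1 := (hasDerivWithinAt_iff_tendsto_slope.1 (hderiv t ht i)).eventually_const_lt
        (hb t ht hpast i h.symm)
      rw [Ici_sdiff_left] at h1
      filter_upwards [h1, self_mem_nhdsWithin] with s hs hst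
      rw [slope_def_field, ← h, sub_zero] at hs
      exact ((div_pos_iff_of_pos_right (sub_pos.2 hst)).1 hs).le
    · have h1 := ((hderiv t ht i).continuousWithinAt.mono Ioi_subset_Ici_self).eventually_const_lt h
      exact h1.mono fun s hs => hs.le
  obtain ⟨t', ht', h⟩ := mem_nhdsGT_iff_exists_Ioc_subset.1 hev
  exact ⟨t', ht', fun s hs i => h hs i⟩

/-- Homogeneity only multiplies coordinate `i` of `f v + g v` by a positive power of `c`. -/
theorem dilation_apply_add {f g : (Fin n → ℝ) → (Fin n → ℝ)} {r : Fin n → ℝ} {p : ℝ}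
    (hf_hom : IsHomogeneousField r p f) (hg_hom : IsHomogeneousField r p g)
    {v : Fin n → ℝ} (hneg : ∀ i, f v i + g v i < 0) {c : ℝ} (hc : 0 < c) (i : Fin n) :
    f (dilation r c v) i + g (dilation r c v) i < 0 := by
  rw [hf_hom v c hc, hg_hom v c hc]
  simp only [Pi.smul_apply, dilation, smul_eq_mul]
  rw [← mul_add, ← mul_add]
  exact mul_neg_of_pos_of_neg (Real.rpow_pos_of_pos hc _)
    (mul_neg_of_pos_of_neg (Real.rpow_pos_of_pos hc _) (hneg i))

theorem dilation_nonneg {r v : Fin n → ℝ} (hv : ∀ i, 0 < v i) {c : ℝ} (hc : 0 < c) :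
    0 ≤ dilation r c v := fun i =>
  mul_nonneg (Real.rpow_nonneg hc.le _) (hv i).le

theorem dilation_mono {r v : Fin n → ℝ} (hr : ∀ i, 0 < r i) (hv : ∀ i, 0 < v i) {c d : ℝ}
    (hc : 0 ≤ c) (hcd : c ≤ d) : dilation r c v ≤ dilation r d v := fun i =>
  mul_le_mul_of_nonneg_right (Real.rpow_le_rpow hc hcd (hr i).le) (hv i).le

theorem exists_dilation_ge {r v : Fin n → ℝ} (hr : ∀ i, 0 < r i) (hv : ∀ i, 0 < v i) (K : ℝ) :
    ∃ c > 0, ∀ i, K ≤ dilation r c v i := by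
  have h : ∀ᶠ c : ℝ in atTop, ∀ i, K ≤ dilation r c v i := eventually_all.2 fun i =>
    ((tendsto_rpow_atTop (hr i)).atTop_mul_const (hv i)).eventually_ge_atTop K
  obtain ⟨c, hc, h0⟩ := (h.and (eventually_gt_atTop 0)).exists
  exact ⟨c, h0, hc⟩

theorem exists_dilation_lt {r v : Fin n → ℝ} (hr : ∀ i, 0 < r i) {ε : ℝ}
    (hε : 0 < ε) : ∃ c > 0, ∀ i, dilation r c v i < ε := by
  have h : ∀ᶠ c : ℝ in 𝓝[>] 0, ∀ i, dilation r c v i < ε := eventually_all.2 fun i => by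
    have h1 : Tendsto (fun c : ℝ => c ^ r i * v i) (𝓝 0) (𝓝 ((0 : ℝ) ^ r i * v i)) :=
      ((Real.continuousAt_rpow_const 0 (r i) (Or.inr (hr i).le)).tendsto).mul_const _
    rw [Real.zero_rpow (hr i).ne', zero_mul] at h1
    exact (h1.mono_left nhdsWithin_le_nhds).eventually_lt_const hε
  obtain ⟨c, hc, h0⟩ := (h.and self_mem_nhdsWithin).exists
  exact ⟨c, h0, hc⟩

/-! ### Stability and attractivity by comparison -/

section Stability

variable {f g : (Fin n → ℝ) → (Fin n → ℝ)} {τ : ℝ → ℝ} {φ x : ℝ → Fin n → ℝ}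

/-- Comparison of a nonnegative solution with an affine upper barrier. -/
theorem IsSolution.le_affine_barrier (hf_coop : IsCooperative f)
    (hg_mono : IsNondecreasingField g) (hx : IsSolution f g τ φ x)
    {a b : ℝ} (ha : 0 ≤ a) (hnn : ∀ t, 0 ≤ t → 0 ≤ x t ∧ 0 ≤ x (t - τ t)) {V w z : Fin n → ℝ}
    (hxa : x a ≤ V)
    (hdelay : ∀ t ∈ Ico a b, (∀ s ∈ Icc a t, x s ≤ V + (s - a) • w) → x (t - τ t) ≤ z)
    (hneg : ∀ t ∈ Ico a b, ∀ i, f (V + (t - a) • w) i + g z i < w i) :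
    ∀ t ∈ Icc a b, x t ≤ V + (t - a) • w := by
  have hBd : ∀ t i, HasDerivAt (fun s => (V + (s - a) • w) i) (w i) t := fun t i => by
    simpa using ((((hasDerivAt_id t).sub_const a).mul_const (w i)).const_add (V i))
  have key := nonneg_of_deriv_right_pos (u := fun t => V + (t - a) • w - x t)
    (u' := fun t i => w i - (f (x t) i + g (x (t - τ t)) i)) (a := a) (b := b)
    ((Continuous.continuousOn (by fun_prop)).sub (hx.continuousOn.mono fun s hs => ha.trans hs.1))
    (fun t ht i => (hBd t i).hasDerivWithinAt.sub (hx.deriv_coord (ha.trans ht.1) i))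
    (by simpa using hxa)
    -- At a contact in coordinate `i`, quasimonotonicity bounds `f (x t) i` by its value on the
    -- barrier, so the gap has strictly positive right derivative.
    (fun t ht hpast i hi => by
      have hle : x t ≤ V + (t - a) • w := sub_nonneg.1 (hpast t (right_mem_Icc.2 ht.1))
      have h0 := hnn t (ha.trans ht.1)
      have h1 := le_of_nonneg_of_eq_coord hf_coop h0.1 hle (sub_eq_zero.1 hi).symm
      have h2 := hg_mono _ _ h0.2 (hdelay t ht fun s hs => sub_nonneg.1 (hpast s hs)) i
      linarith [hneg t ht i])
  exact fun t ht => sub_nonneg.1 (key t ht)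

/-- This is the barrier with zero speed: the delayed state lies in the same box, whatever the size
of the delay. -/
theorem IsSolution.le_of_initial_le (hf_coop : IsCooperative f)
    (hg_mono : IsNondecreasingField g) (hτ : IsAdmissibleDelay τ) (hx : IsSolution f g τ φ x)
    (hnn : ∀ t, -maxDelay τ ≤ t → 0 ≤ x t) {V : Fin n → ℝ}
    (hV : ∀ i, f V i + g V i < 0) (hφ : ∀ s ∈ Icc (-maxDelay τ) 0, φ s ≤ V) {t : ℝ}
    (ht : -maxDelay τ ≤ t) : x t ≤ V := by
  have hinit : ∀ s ∈ Icc (-maxDelay τ) 0, x s ≤ V := fun s hs => by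
    rw [hx.initial s hs]; exact hφ s hs
  have hτ0 := hτ.maxDelay_nonneg
  rcases le_total t 0 with h | h
  · exact hinit t ⟨ht, h⟩
  have := hx.le_affine_barrier hf_coop hg_mono (a := 0) (b := t) (V := V) (w := 0) (z := V) le_rfl
    (fun s hs => ⟨hnn s (by linarith), hnn _ (hτ.neg_maxDelay_le hs)⟩)
    (hinit 0 ⟨by linarith, le_rfl⟩)
    (fun s hs hpast => by
      rcases le_total (s - τ s) 0 with h0 | h0
      · exact hinit _ ⟨hτ.neg_maxDelay_le hs.1, h0⟩
      · simpa using hpast _ ⟨h0, by linarith [hτ.nonneg s hs.1]⟩)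
    (fun s _ i => by simpa using hV i) t (right_mem_Icc.2 h)
  simpa using this

/-- The infimum `l` of the admissible scales must be 0. Otherwise continuity of `f` and `g` at
`dilation r l v` leaves room `η` to push the solution from scale `l + e` to `l - e`. -/
theorem IsSolution.eventually_le_of_le_dilation {r v : Fin n → ℝ} (hr : ∀ i, 0 < r i)
    (hv : ∀ i, 0 < v i) (hfc : Continuous f) (hgc : Continuous g) (hf_coop : IsCooperative f)
    (hg_mono : IsNondecreasingField g) (hτ : IsAdmissibleDelay τ) (hx : IsSolution f g τ φ x)
    (hnn : ∀ t, -maxDelay τ ≤ t → 0 ≤ x t)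
    (hneg : ∀ c > 0, ∀ i, f (dilation r c v) i + g (dilation r c v) i < 0)
    {c₀ : ℝ} (hc₀ : 0 < c₀) (hle : ∀ᶠ t in atTop, x t ≤ dilation r c₀ v)
    {c : ℝ} (hc : 0 < c) : ∀ᶠ t in atTop, x t ≤ dilation r c v := by
  set S : Set ℝ := {c | 0 < c ∧ ∀ᶠ t in atTop, x t ≤ dilation r c v} with hS
  have hSne : S.Nonempty := ⟨c₀, hc₀, hle⟩
  have hSbdd : BddBelow S := ⟨0, fun d hd => hd.1.le⟩
  have hup : ∀ d, sInf S < d → ∀ᶠ t in atTop, x t ≤ dilation r d v := by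
    intro d hd
    obtain ⟨e, he, hed⟩ := exists_lt_of_csInf_lt hSne hd
    exact he.2.mono fun t ht => ht.trans (dilation_mono hr hv he.1.le hed.le)
  rcases (show 0 ≤ sInf S from le_csInf hSne fun d hd => hd.1.le).eq_or_lt with h0 | hpos
  · exact hup c (h0 ▸ hc)
  exfalso
  set l := sInf S
  have hexη : ∃ η > 0, ∀ i, f (dilation r l v) i + g (dilation r l v) i < -η := by
    have h : ∀ᶠ η : ℝ in 𝓝[>] 0, ∀ i, f (dilation r l v) i + g (dilation r l v) i < -η := by
      refine eventually_all.2 fun i => ?_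
      have h1 : Tendsto (fun η : ℝ => -η) (𝓝[>] 0) (𝓝 0) := by
        have : Tendsto (fun η : ℝ => -η) (𝓝 0) (𝓝 (-0)) := tendsto_id.neg
        rw [neg_zero] at this
        exact this.mono_left nhdsWithin_le_nhds
      exact h1.eventually_const_lt (hneg l hpos i)
    obtain ⟨η, h1, h2⟩ := (h.and self_mem_nhdsWithin).exists
    exact ⟨η, h2, h1⟩
  obtain ⟨η, hη, hηl⟩ := hexη
  have hnear : ∀ᶠ q : (Fin n → ℝ) × (Fin n → ℝ) in 𝓝 (dilation r l v, dilation r l v),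
      ∀ i, f q.1 i + g q.2 i < -η := by
    refine eventually_all.2 fun i => ?_
    have hcont : Continuous fun q : (Fin n → ℝ) × (Fin n → ℝ) => f q.1 i + g q.2 i := by fun_prop
    exact hcont.continuousAt.eventually_lt_const (hηl i)
  obtain ⟨ρ, hρ, hball⟩ := Metric.eventually_nhds_iff_ball.1 hnear
  have hdc : ContinuousAt (fun d => dilation r d v) l := by
    refine continuousAt_pi.2 fun i => ?_
    exact (Real.continuousAt_rpow_const l (r i) (Or.inl hpos.ne')).mul_const _
  obtain ⟨δ, hδ, hδball⟩ := Metric.eventually_nhds_iff_ball.1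
    (hdc.eventually (Metric.ball_mem_nhds _ (lt_min hρ (half_pos hη))))
  set e := min (δ / 2) (l / 2) with he
  have he0 : 0 < e := lt_min (by linarith) (by linarith)
  have heδ : e ≤ δ / 2 := min_le_left _ _
  have hel : e ≤ l / 2 := min_le_right _ _
  set V₁ := dilation r (l + e) v with hV₁
  set V₂ := dilation r (l - e) v with hV₂
  have hb₁ : V₁ ∈ Metric.ball (dilation r l v) (min ρ (η / 2)) := hδball (l + e) (by
    rw [Metric.mem_ball, Real.dist_eq, add_sub_cancel_left, abs_of_pos he0]; linarith)
  have hb₂ : V₂ ∈ Metric.ball (dilation r l v) (min ρ (η / 2)) := hδball (l - e) (by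
    rw [Metric.mem_ball, Real.dist_eq, sub_sub_cancel_left, abs_neg, abs_of_pos he0]; linarith)
  have hsub : Metric.ball (dilation r l v) (min ρ (η / 2)) ⊆ Metric.ball (dilation r l v) ρ :=
    Metric.ball_subset_ball (min_le_left _ _)
  -- Both corners are within `η / 2` of `dilation r l v`, so a barrier moving from `V₁` to `V₂` in
  -- unit time descends more slowly than the rate `η` forced by the fields.
  have hdist : ∀ i, -η < (V₂ - V₁) i := by
    intro i
    have h1 : dist V₂ V₁ < η := by
      have h2 := Metric.mem_ball.1 (Metric.ball_subset_ball (min_le_right _ _) hb₁)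
      have h3 := Metric.mem_ball.1 (Metric.ball_subset_ball (min_le_right _ _) hb₂)
      have := dist_triangle_right V₂ V₁ (dilation r l v)
      linarith
    rw [dist_eq_norm] at h1
    have h2 := (norm_le_pi_norm (V₂ - V₁) i).trans_lt h1
    exact (abs_lt.1 h2).1
  have hpair : ∀ y ∈ Metric.ball (dilation r l v) ρ, ∀ i, f y i + g V₁ i < -η := fun y hy i =>
    hball (y, V₁) (by
      rw [Metric.mem_ball, Prod.dist_eq]
      exact max_lt (Metric.mem_ball.1 hy) (Metric.mem_ball.1 (hsub hb₁))) i
  obtain ⟨T₁, hT₁⟩ := eventually_atTop.1 (hup (l + e) (by linarith))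
  obtain ⟨T₂, hT₂⟩ := eventually_atTop.1
    ((hτ.tendsto.eventually_ge_atTop T₁).and ((eventually_ge_atTop 0).and (eventually_ge_atTop T₁)))
  have hT₂0 : 0 ≤ T₂ := (hT₂ T₂ le_rfl).2.1
  have hnn' : ∀ t, 0 ≤ t → 0 ≤ x t ∧ 0 ≤ x (t - τ t) := fun s hs =>
    ⟨hnn s (by linarith [hτ.maxDelay_nonneg]), hnn _ (hτ.neg_maxDelay_le hs)⟩
  have hstep := hx.le_affine_barrier hf_coop hg_mono (a := T₂) (b := T₂ + 1) (V := V₁)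
    (w := V₂ - V₁) (z := V₁) hT₂0 hnn' (hT₁ T₂ (hT₂ T₂ le_rfl).2.2)
    (fun t ht _ => hT₁ _ (hT₂ t ht.1).1)
    (fun t ht i => (hpair _ (hsub ((convex_ball _ _).add_smul_sub_mem hb₁ hb₂
      ⟨by linarith [ht.1], by linarith [ht.2]⟩)) i).trans (hdist i))
    (T₂ + 1) (right_mem_Icc.2 (by linarith))
  rw [add_sub_cancel_left, one_smul, add_sub_cancel] at hstep
  have hmem : l - e ∈ S := by
    refine ⟨by linarith, eventually_atTop.2 ⟨T₂ + 1, fun t ht => ?_⟩⟩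
    -- The barrier now rests at `V₂`. Delayed values need only lie below `V₁`, since `f V₂ + g V₁`
    -- is already negative.
    have := hx.le_affine_barrier hf_coop hg_mono (a := T₂ + 1) (b := t) (V := V₂)
      (w := 0) (z := V₁) (by linarith) hnn' hstep
      (fun s hs _ => hT₁ _ (hT₂ s (by linarith [hs.1])).1)
      (fun s hs i => by
        rw [smul_zero, add_zero]
        exact (hpair _ (hsub hb₂) i).trans (neg_lt_zero.2 hη))
      t (right_mem_Icc.2 ht)
    simpa using this
  have := csInf_le hSbdd hmem
  linarith

theorem exists_initial_le_dilation {r v : Fin n → ℝ} (hr : ∀ i, 0 < r i) (hv : ∀ i, 0 < v i)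
    (hφ : IsNonnegInitial τ φ) :
    ∃ c > 0, ∀ s ∈ Icc (-maxDelay τ) 0, φ s ≤ dilation r c v := by
  obtain ⟨K, hK⟩ := isCompact_Icc.exists_bound_of_continuousOn hφ.continuousOn
  obtain ⟨c, hc, h⟩ := exists_dilation_ge hr hv K
  exact ⟨c, hc, fun s hs i =>
    ((le_abs_self _).trans ((norm_le_pi_norm (φ s) i).trans (hK s hs))).trans (h i)⟩

theorem IsSolution.tendsto_zero {r v : Fin n → ℝ} (hr : ∀ i, 0 < r i)
    (hv : ∀ i, 0 < v i) (hfc : Continuous f) (hgc : Continuous g) (hf_coop : IsCooperative f)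
    (hg_mono : IsNondecreasingField g) (hτ : IsAdmissibleDelay τ) (hφ : IsNonnegInitial τ φ)
    (hx : IsSolution f g τ φ x) (hnn : ∀ t, -maxDelay τ ≤ t → 0 ≤ x t)
    (hneg : ∀ c > 0, ∀ i, f (dilation r c v) i + g (dilation r c v) i < 0) :
    Tendsto x atTop (𝓝 0) := by
  have hτ0 := hτ.maxDelay_nonneg
  obtain ⟨c₀, hc₀, hφc⟩ := exists_initial_le_dilation hr hv hφ
  have hle : ∀ᶠ t in atTop, x t ≤ dilation r c₀ v := by
    filter_upwards [eventually_ge_atTop 0] with t ht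
    exact hx.le_of_initial_le hf_coop hg_mono hτ hnn (hneg c₀ hc₀) hφc (by linarith)
  rw [Metric.tendsto_nhds]
  intro ε hε
  obtain ⟨c, hc, hcε⟩ := exists_dilation_lt (v := v) hr hε
  filter_upwards [hx.eventually_le_of_le_dilation hr hv hfc hgc hf_coop hg_mono hτ hnn hneg hc₀
    hle hc, eventually_ge_atTop 0] with t ht ht0
  rw [dist_zero_right, pi_norm_lt_iff hε]
  intro i
  rw [Real.norm_of_nonneg (hnn t (by linarith) i)]
  exact (ht i).trans_lt (hcε i)

end Stability

/-! ### Subequilibria and construction of `v` -/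

/-- A solution of a cooperative autonomous system starting at a nonzero subequilibrium stays
above it. -/
theorem le_of_subequilibrium {h : (Fin n → ℝ) → (Fin n → ℝ)} (hh : ContDiffOn ℝ 1 h {0}ᶜ)
    (hq : ∀ (x y : Fin n → ℝ) (i : Fin n), 0 ≤ x → x ≤ y → x i = y i → h x i ≤ h y i)
    {y : Fin n → ℝ} (hy : 0 ≤ y) (hy0 : y ≠ 0) (hhy : 0 ≤ h y) {x : ℝ → Fin n → ℝ}
    (hx : ∀ t, 0 ≤ t → HasDerivWithinAt x (h (x t)) (Ici 0) t) (hx0 : x 0 = y) {t : ℝ}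
    (ht : 0 ≤ t) : y ≤ x t := by
  have hxc : ContinuousOn x (Ici 0) := fun t ht => (hx t ht).continuousWithinAt
  refine forall_mem_Icc_of_step (P := fun t => y ≤ x t) (a := 0) (b := t)
    ((hxc.mono Icc_subset_Ici_self).preimage_isClosed_of_isClosed isClosed_Icc isClosed_Ici)
    hx0.ge ?_ t (right_mem_Icc.2 ht)
  intro t₀ ht₀ hpast
  have hyx : y ≤ x t₀ := hpast t₀ (right_mem_Icc.2 ht₀.1)
  have hxne : x t₀ ≠ 0 := fun h0 => hy0 (le_antisymm (h0 ▸ hyx) hy)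
  obtain ⟨K, U, hU, hK⟩ :=
    (hh.contDiffAt (isOpen_compl_singleton.mem_nhds hxne)).exists_lipschitzOnWith
  have hxt : ContinuousWithinAt x (Ici t₀) t₀ :=
    (hxc t₀ ht₀.1).mono (Ici_subset_Ici.2 ht₀.1)
  have hxyt : Tendsto (fun s => x s ⊔ y) (𝓝[≥] t₀) (𝓝 (x t₀)) := by
    have : Tendsto (fun s => x s ⊔ y) (𝓝[≥] t₀) (𝓝 (x t₀ ⊔ y)) := tendsto_pi_nhds.2 fun i =>
      (tendsto_pi_nhds.1 hxt.tendsto i).sup_nhds tendsto_const_nhds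
    rwa [sup_of_le_left hyx] at this
  obtain ⟨b₁, hb₁, hsub⟩ := mem_nhdsGE_iff_exists_Icc_subset.1
    ((hxt.tendsto.eventually_mem hU).and (hxyt.eventually_mem hU))
  set T := min (b₁ - t₀) (1 / (2 * (K + 1))) with hT
  have hTpos : 0 < T := lt_min (sub_pos.2 hb₁) (by positivity)
  have hKT : K * T ≤ 1 / 2 := by
    calc (K : ℝ) * T ≤ (K + 1) * (1 / (2 * (K + 1))) := by
          gcongr
          · linarith
          · exact min_le_right _ _
      _ = 1 / 2 := by
          have : (K : ℝ) + 1 ≠ 0 := by positivity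
          field_simp
  set b := t₀ + T with hb
  have hsub' : ∀ s ∈ Icc t₀ b, x s ∈ U ∧ x s ⊔ y ∈ U := fun s hs =>
    hsub ⟨hs.1, hs.2.trans (by rw [hb]; linarith [min_le_left (b₁ - t₀) (1 / (2 * (K + 1 : ℝ)))])⟩
  have hxcb : ContinuousOn x (Icc t₀ b) := hxc.mono fun s hs => ht₀.1.trans hs.1
  obtain ⟨κ, hκ⟩ := isCompact_Icc.exists_bound_of_continuousOn
    ((continuousOn_const (c := y)).sub hxcb)
  have hκ0 : 0 ≤ κ := (norm_nonneg _).trans (hκ t₀ (left_mem_Icc.2 (by linarith)))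
  -- Where `x s i ≤ y i`, the field at `x s ⊔ y` is nonnegative in coordinate `i`, so at `x s` it is
  -- at least `-K` times the deficit bound. As `K * T ≤ 1 / 2`, each pass halves that bound.
  have hhalf : ∀ k : ℕ, ∀ t ∈ Icc t₀ b, ∀ i, y i - x t i ≤ (1 / 2) ^ k * κ := by
    intro k
    induction k with
    | zero =>
      intro t ht i
      rw [pow_zero, one_mul]
      exact (le_abs_self _).trans ((norm_le_pi_norm (y - x t) i).trans (hκ t ht))
    | succ k ih =>
      intro t ht i
      have hκk : 0 ≤ (1 / 2) ^ k * κ := by positivity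
      have hlow := neg_mul_sub_le_of_deriv_right (y := fun s => x s i - y i)
        (y' := fun s => h (x s) i) (a := t₀) (b := t) (B := K * ((1 / 2) ^ k * κ)) (by positivity)
        (((continuous_apply i).comp_continuousOn
          (hxcb.mono (Icc_subset_Icc_right ht.2))).sub continuousOn_const)
        (fun s hs => ((hasDerivWithinAt_pi.1 (hx s (ht₀.1.trans hs.1)) i).mono
          (Ici_subset_Ici.2 (ht₀.1.trans hs.1))).sub_const _)
        (sub_nonneg.2 (hyx i))
        (fun s hs hsi => by
          have hs' : s ∈ Icc t₀ b := ⟨hs.1, hs.2.le.trans ht.2⟩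
          have h1 : ‖(x s ⊔ y) - x s‖ ≤ (1 / 2) ^ k * κ := by
            rw [pi_norm_le_iff_of_nonneg hκk]
            intro j
            rw [Pi.sub_apply, Pi.sup_apply, Real.norm_eq_abs]
            rcases le_total (x s j) (y j) with h2 | h2
            · rw [sup_of_le_right h2, abs_of_nonneg (sub_nonneg.2 h2)]
              exact ih s hs' j
            · rw [sup_of_le_left h2, sub_self, abs_zero]
              exact hκk
          have h2 := hK.norm_sub_le (hsub' s hs').2 (hsub' s hs').1
          have h3 := (norm_le_pi_norm (h (x s ⊔ y) - h (x s)) i).trans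
            (h2.trans (mul_le_mul_of_nonneg_left h1 K.2))
          have h4 : h y i ≤ h (x s ⊔ y) i := hq y _ i hy le_sup_right
            (sup_of_le_right (sub_nonpos.1 hsi)).symm
          have h5 : 0 ≤ h y i := hhy i
          have h6 := (abs_le.1 h3).2
          rw [Pi.sub_apply] at h6
          linarith) t (right_mem_Icc.2 ht.1)
      have h1 : K * ((1 / 2) ^ k * κ) * (t - t₀) ≤ K * ((1 / 2) ^ k * κ) * T := by
        gcongr; linarith [ht.2]
      have h2 := mul_le_mul_of_nonneg_right hKT hκk
      rw [pow_succ]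
      linarith
  refine ⟨b, by linarith, fun t ht i => ?_⟩
  have hlim : Tendsto (fun k : ℕ => (1 / 2 : ℝ) ^ k * κ) atTop (𝓝 (0 * κ)) :=
    (tendsto_pow_atTop_nhds_zero_of_lt_one (by norm_num) (by norm_num)).mul_const _
  have := ge_of_tendsto' hlim fun k => hhalf k t ⟨ht.1.le, ht.2⟩ i
  rw [zero_mul] at this
  linarith

/-- If a quasimonotone field has no nonzero subequilibrium in the orthant, then it is strictly
negative at some positive vector. -/
theorem exists_pos_apply_neg {h : (Fin n → ℝ) → (Fin n → ℝ)} (hc : Continuous h) (h0 : h 0 = 0)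
    (hq : ∀ (x y : Fin n → ℝ) (i : Fin n), 0 ≤ x → x ≤ y → x i = y i → h x i ≤ h y i)
    (hno : ∀ y : Fin n → ℝ, 0 ≤ y → y ≠ 0 → ¬ 0 ≤ h y) :
    ∃ v : Fin n → ℝ, (∀ i, 0 < v i) ∧ ∀ i, h v i < 0 := by
  have hnegc : Continuous fun x => ‖h x ⊓ 0‖ := 
    (continuous_pi fun i => ((continuous_apply i).comp hc).inf continuous_const).norm
  obtain ⟨c, hc0, hcS⟩ := ((isCompact_sphere (0 : Fin n → ℝ) 1).inter_right
    (isClosed_Ici (a := (0 : Fin n → ℝ)))).exists_forall_le' hnegc.continuousOn (a := 0) (by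
      rintro x ⟨hx1, hx0⟩
      refine norm_pos_iff.2 fun hx => ?_
      refine hno x hx0 ?_ (inf_eq_right.1 hx)
      rintro rfl
      simp at hx1)
  set ε := c / 2 with hε
  have hε0 : 0 < ε := half_pos hc0
  -- A maximizer `v` of the coordinate sum over `A` is sought. It avoids the faces `v i = 1`, where
  -- the negative part of `h` has norm at least `c > ε`.
  set A : Set (Fin n → ℝ) := Icc 0 1 ∩ {x | ∀ i, -ε ≤ h x i} with hA
  have hAcl : IsClosed {x : Fin n → ℝ | ∀ i, -ε ≤ h x i} := by
    simp only [ofPred_forall]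
    exact isClosed_iInter fun i => isClosed_le continuous_const ((continuous_apply i).comp hc)
  have hAc : IsCompact A := isCompact_Icc.inter_right hAcl
  have hA0 : (0 : Fin n → ℝ) ∈ A := by
    refine ⟨⟨le_rfl, zero_le_one⟩, fun i => ?_⟩
    rw [h0, Pi.zero_apply]; linarith
  obtain ⟨v, hvA, hvmax⟩ := hAc.exists_isMaxOn ⟨0, hA0⟩
    (f := fun x => ∑ i, x i) (Continuous.continuousOn (by fun_prop))
  have hv0 : 0 ≤ v := hvA.1.1
  have hvlt : ∀ i, v i < 1 := by
    intro i
    by_contra hi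
    have hi1 : v i = 1 := le_antisymm (hvA.1.2 i) (not_lt.1 hi)
    have hnorm : ‖v‖ = 1 := by
      refine le_antisymm ((pi_norm_le_iff_of_nonneg zero_le_one).2 fun j => ?_) ?_
      · rw [Real.norm_of_nonneg (hv0 j)]; exact hvA.1.2 j
      · have := norm_le_pi_norm v i
        rwa [hi1, norm_one] at this
    have h1 := hcS v ⟨by simpa using hnorm, hv0⟩
    have h2 : ‖h v ⊓ 0‖ ≤ ε := by
      rw [pi_norm_le_iff_of_nonneg hε0.le]
      intro j
      rw [Pi.inf_apply, Pi.zero_apply, Real.norm_of_nonpos inf_le_right, neg_le]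
      exact le_inf (hvA.2 j) (by linarith)
    linarith
  -- If `h v i > -ε`, coordinate `i` can be raised slightly: quasimonotonicity keeps the other
  -- constraints, contradicting maximality.
  have heq : ∀ i, h v i = -ε := by
    intro i
    refine le_antisymm (not_lt.1 fun hi => ?_) (hvA.2 i)
    have hcont : Continuous fun s : ℝ => v + Pi.single i s :=
      continuous_const.add (continuous_single (A := fun _ : Fin n => ℝ) i)
    have hev1 : ∀ᶠ s : ℝ in 𝓝 0, -ε < h (v + Pi.single i s) i := by
      refine (((continuous_apply i).comp (hc.comp hcont)).tendsto 0).eventually_const_lt ?_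
      simpa using hi
    have hev2 : ∀ᶠ s : ℝ in 𝓝 0, v i + s < 1 := by
      refine ((continuous_const.add continuous_id).tendsto (0 : ℝ)).eventually_lt_const ?_
      simpa using hvlt i
    obtain ⟨s, ⟨hs1, hs2⟩, hs0⟩ := (((hev1.and hev2).filter_mono nhdsWithin_le_nhds).and
      (self_mem_nhdsWithin (s := Ioi (0 : ℝ)))).exists
    have hs0 : 0 < s := hs0
    have hle : v ≤ v + Pi.single i s := le_add_of_nonneg_right (Pi.single_nonneg.2 hs0.le)
    have hmem : v + Pi.single i s ∈ A := by
      refine ⟨⟨hv0.trans hle, fun j => ?_⟩, fun j => ?_⟩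
      · by_cases hj : j = i
        · subst hj; simpa using hs2.le
        · simpa [hj] using hvA.1.2 j
      · by_cases hj : j = i
        · subst hj; exact hs1.le
        · exact (hvA.2 j).trans (hq v _ j hv0 hle (by simp [hj]))
    have h1 : ∑ j, (v j + (Pi.single i s : Fin n → ℝ) j) ≤ ∑ j, v j := hvmax hmem
    rw [Finset.sum_add_distrib, Finset.sum_pi_single', if_pos (Finset.mem_univ i)] at h1
    linarith
  -- A vanishing coordinate would give `h v i ≥ h 0 i = 0`, not `-ε`.
  refine ⟨v, fun i => (show (0 : ℝ) ≤ v i from hv0 i).lt_of_ne fun hi => ?_, fun i => ?_⟩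
  · have := hq 0 v i le_rfl hv0 (by simpa using hi)
    rw [h0, heq i, Pi.zero_apply] at this
    linarith
  · rw [heq i]; linarith

/-! ### Existence by monotone iteration -/

/-- The integrand of the variation-of-constants formula for the delay equation, after adding the
linear term `c x`; `θ` is the delayed time. -/
noncomputable def mildIntegrand (f g : (Fin n → ℝ) → (Fin n → ℝ)) (c : ℝ) (θ : ℝ → ℝ)
    (X : ℝ → Fin n → ℝ) (i : Fin n) (s : ℝ) : ℝ :=
  Real.exp (c * s) * (f (X s) i + c * X s i + g (X (θ s)) i)

/-- The integral operator whose fixed points are the solutions of the delay equation with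
history `ψ`. -/
noncomputable def mildMap (f g : (Fin n → ℝ) → (Fin n → ℝ)) (c : ℝ) (θ : ℝ → ℝ)
    (ψ X : ℝ → Fin n → ℝ) : ℝ → Fin n → ℝ := fun t i =>
  Real.exp (-(c * max t 0)) * (ψ t i + ∫ s in (0 : ℝ)..max t 0, mildIntegrand f g c θ X i s)

section Mild

variable {f g : (Fin n → ℝ) → (Fin n → ℝ)} {c : ℝ} {θ : ℝ → ℝ} {V : Fin n → ℝ}
  {ψ X Y : ℝ → Fin n → ℝ}

theorem exists_mildIntegrand_bound (hf : Continuous f) (hg : Continuous g) (c : ℝ) (θ : ℝ → ℝ)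
    (V : Fin n → ℝ) :
    ∃ K : ℝ, ∀ X : ℝ → Fin n → ℝ, (∀ t, X t ∈ Icc 0 V) →
      ∀ i s, ‖mildIntegrand f g c θ X i s‖ ≤ Real.exp (c * s) * K := by
  obtain ⟨K₁, hK₁⟩ := (isCompact_Icc (a := (0 : Fin n → ℝ)) (b := V)).exists_bound_of_continuousOn
    (f := fun x => f x + c • x) (Continuous.continuousOn (by fun_prop))
  obtain ⟨K₂, hK₂⟩ := (isCompact_Icc (a := (0 : Fin n → ℝ)) (b := V)).exists_bound_of_continuousOn
    hg.continuousOn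
  refine ⟨K₁ + K₂, fun X hX i s => ?_⟩
  rw [mildIntegrand, norm_mul, Real.norm_of_nonneg (Real.exp_pos _).le]
  gcongr
  refine (norm_add_le _ _).trans (add_le_add ?_ ?_)
  · exact (norm_le_pi_norm (f (X s) + c • X s) i).trans (hK₁ _ (hX s))
  · exact (norm_le_pi_norm (g (X (θ s))) i).trans (hK₂ _ (hX (θ s)))

theorem measurable_mildIntegrand (hf : Continuous f) (hg : Continuous g) (hθ : Continuous θ)
    (hX : Measurable X) (i : Fin n) : Measurable (mildIntegrand f g c θ X i) := by
  have h1 : Measurable fun s => f (X s) i := (measurable_pi_apply i).comp (hf.measurable.comp hX)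
  have h2 : Measurable fun s => X s i := (measurable_pi_apply i).comp hX
  have h3 : Measurable fun s => g (X (θ s)) i :=
    (measurable_pi_apply i).comp (hg.measurable.comp (hX.comp hθ.measurable))
  have h4 : Measurable fun s : ℝ => Real.exp (c * s) := by fun_prop
  exact h4.mul ((h1.add (h2.const_mul c)).add h3)

theorem intervalIntegrable_mildIntegrand (hf : Continuous f) (hg : Continuous g)
    (hθ : Continuous θ) (hX : Measurable X) (hXV : ∀ t, X t ∈ Icc 0 V) (i : Fin n) (a b : ℝ) :
    IntervalIntegrable (mildIntegrand f g c θ X i) MeasureTheory.volume a b := by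
  obtain ⟨K, hK⟩ := exists_mildIntegrand_bound hf hg c θ V
  refine IntervalIntegrable.mono_fun'
    (g := fun s => Real.exp (c * s) * K) (Continuous.intervalIntegrable (by fun_prop) _ _)
    (measurable_mildIntegrand hf hg hθ hX i).aestronglyMeasurable ?_
  exact Eventually.of_forall fun s => hK X hXV i s

theorem continuous_mildMap (hf : Continuous f) (hg : Continuous g)
    (hθ : Continuous θ) (hψ : Continuous ψ) (hX : Measurable X) (hXV : ∀ t, X t ∈ Icc 0 V) :
    Continuous (mildMap f g c θ ψ X) := by
  refine continuous_pi fun i => ?_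
  have h1 : Continuous fun t : ℝ => Real.exp (-(c * max t 0)) := by fun_prop
  have h2 : Continuous fun t : ℝ => ∫ s in (0 : ℝ)..max t 0, mildIntegrand f g c θ X i s :=
    (intervalIntegral.continuous_primitive
      (fun a b => intervalIntegrable_mildIntegrand hf hg hθ hX hXV i a b) 0).comp
      (continuous_id.max continuous_const)
  exact h1.mul (((continuous_apply i).comp hψ).add h2)

theorem mildMap_mono (hf : Continuous f) (hg : Continuous g) (hθ : Continuous θ)
    (hg_mono : IsNondecreasingField g)
    (hshift : ∀ x y : Fin n → ℝ, 0 ≤ x → x ≤ y → y ≤ V → ∀ i, f x i + c * x i ≤ f y i + c * y i)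
    (hX : Measurable X) (hXV : ∀ t, X t ∈ Icc 0 V) (hY : Measurable Y)
    (hYV : ∀ t, Y t ∈ Icc 0 V) (hXY : X ≤ Y) : mildMap f g c θ ψ X ≤ mildMap f g c θ ψ Y := by
  intro t i
  refine mul_le_mul_of_nonneg_left (add_le_add_right ?_ _) (Real.exp_pos _).le
  refine intervalIntegral.integral_mono_on (le_max_right _ _)
    (intervalIntegrable_mildIntegrand hf hg hθ hX hXV i _ _)
    (intervalIntegrable_mildIntegrand hf hg hθ hY hYV i _ _) fun s _ => ?_
  refine mul_le_mul_of_nonneg_left (add_le_add ?_ ?_) (Real.exp_pos _).le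
  · exact hshift _ _ (hXV s).1 (hXY s) (hYV s).2 i
  · exact hg_mono _ _ (hXV _).1 (hXY _) i

theorem mildMap_zero_nonneg (hf0 : f 0 = 0) (hg0 : g 0 = 0) (hψ : ∀ t, 0 ≤ ψ t) :
    0 ≤ mildMap f g c θ ψ 0 := by
  intro t i
  have : mildIntegrand f g c θ 0 i = 0 := by
    ext s
    simp [mildIntegrand, hf0, hg0]
  simp only [mildMap, this, Pi.zero_apply, intervalIntegral.integral_zero, add_zero]
  exact mul_nonneg (Real.exp_pos _).le (hψ t i)

/-- Since `f V + c • V + g V ≤ c • V`, the integral is bounded by that of the exact derivative of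
`exp (c * s) * V i`, and the exponentials cancel. -/
theorem mildMap_const_le (hV : ∀ i, f V i + g V i ≤ 0) (hψ : ∀ t, ψ t ≤ V) (t : ℝ) :
    mildMap f g c θ ψ (fun _ => V) t ≤ V := by
  intro i
  set T := max t 0 with hT
  have hint : ∫ s in (0 : ℝ)..T, mildIntegrand f g c θ (fun _ => V) i s
      ≤ (Real.exp (c * T) - 1) * V i := by
    have hd : ∀ s ∈ uIcc 0 T, HasDerivAt (fun s => Real.exp (c * s) * V i)
        (Real.exp (c * s) * (c * V i)) s := fun s _ => by
      have := (((hasDerivAt_id s).const_mul c).exp).mul_const (V i)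
      simpa [mul_assoc] using this
    have hi := intervalIntegral.integral_eq_sub_of_hasDerivAt hd
      (Continuous.intervalIntegrable (by fun_prop) _ _)
    have hle : ∫ s in (0 : ℝ)..T, mildIntegrand f g c θ (fun _ => V) i s
        ≤ ∫ s in (0 : ℝ)..T, Real.exp (c * s) * (c * V i) := by
      refine intervalIntegral.integral_mono_on (le_max_right _ _) ?_ ?_ fun s _ => ?_
      · exact Continuous.intervalIntegrable 
          ((show Continuous fun s : ℝ => Real.exp (c * s) by fun_prop).mul continuous_const) _ _
      · exact Continuous.intervalIntegrable (by fun_prop) _ _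
      · refine mul_le_mul_of_nonneg_left ?_ (Real.exp_pos _).le
        linarith [hV i]
    rw [hi, mul_zero, Real.exp_zero] at hle
    linarith
  have h1 : mildMap f g c θ ψ (fun _ => V) t i
      ≤ Real.exp (-(c * T)) * (V i + (Real.exp (c * T) - 1) * V i) :=
    mul_le_mul_of_nonneg_left (add_le_add (hψ t i) hint) (Real.exp_pos _).le
  refine h1.trans_eq ?_
  have h2 : Real.exp (-(c * T)) * Real.exp (c * T) = 1 := by
    rw [← Real.exp_add, neg_add_cancel, Real.exp_zero]
  linear_combination V i * h2

/-- Monotone iteration from above yields a continuous fixed point. -/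
theorem exists_mildMap_fixedPoint (hf : Continuous f) (hg : Continuous g) (hθ : Continuous θ)
    (hf0 : f 0 = 0) (hg0 : g 0 = 0) (hg_mono : IsNondecreasingField g)
    (hshift : ∀ x y : Fin n → ℝ, 0 ≤ x → x ≤ y → y ≤ V → ∀ i, f x i + c * x i ≤ f y i + c * y i)
    (hV0 : 0 ≤ V) (hV : ∀ i, f V i + g V i ≤ 0) (hψ : Continuous ψ) (hψV : ∀ t, ψ t ∈ Icc 0 V) :
    ∃ X, Continuous X ∧ mildMap f g c θ ψ X = X := by
  set Ψ := mildMap f g c θ ψ with hΨ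
  set Z : ℕ → ℝ → Fin n → ℝ := fun k => Ψ^[k] fun _ => V with hZ
  have hZs : ∀ k, Z (k + 1) = Ψ (Z k) := fun k => Function.iterate_succ_apply' Ψ k _
  have hV' : ∀ t : ℝ, (fun _ : ℝ => V) t ∈ Icc 0 V := fun _ => ⟨hV0, le_rfl⟩
  have hbox : ∀ X : ℝ → Fin n → ℝ, Measurable X → (∀ t, X t ∈ Icc 0 V) →
      ∀ t, Ψ X t ∈ Icc 0 V := fun X hX hXV t =>
    ⟨(mildMap_zero_nonneg hf0 hg0 (fun t => (hψV t).1) t).trans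
      (mildMap_mono hf hg hθ hg_mono hshift measurable_const (fun _ => ⟨le_rfl, hV0⟩) hX hXV
        (fun t => (hXV t).1) t),
    (mildMap_mono hf hg hθ hg_mono hshift hX hXV measurable_const hV'
      (fun t => (hXV t).2) t).trans (mildMap_const_le hV (fun t => (hψV t).2) t)⟩
  have hZbox : ∀ k, Measurable (Z k) ∧ ∀ t, Z k t ∈ Icc 0 V := by
    intro k
    induction k with
    | zero => exact ⟨measurable_const, hV'⟩
    | succ k ih =>
      rw [hZs]
      exact ⟨(continuous_mildMap hf hg hθ hψ ih.1 ih.2).measurable, hbox _ ih.1 ih.2⟩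
  have hanti : Antitone Z := by
    refine antitone_nat_of_succ_le fun k => ?_
    induction k with
    | zero => rw [hZs]; exact fun t => (hbox _ (hZbox 0).1 (hZbox 0).2 t).2
    | succ k ih =>
      rw [hZs (k + 1), hZs k]
      exact mildMap_mono hf hg hθ hg_mono hshift
        (by rw [← hZs]; exact (hZbox (k + 1)).1)
        (by rw [← hZs]; exact (hZbox (k + 1)).2) (hZbox k).1 (hZbox k).2
        (by rw [← hZs]; exact ih)
  set X : ℝ → Fin n → ℝ := fun t i => ⨅ k, Z k t i with hX
  have hlim : ∀ t, Tendsto (fun k => Z k t) atTop (𝓝 (X t)) := fun t =>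
    tendsto_pi_nhds.2 fun i => tendsto_atTop_ciInf (fun a b hab => hanti hab t i)
      ⟨0, by rintro _ ⟨k, rfl⟩; exact ((hZbox k).2 t).1 i⟩
  have hXm : Measurable X := measurable_of_tendsto_metrizable (fun k => (hZbox k).1)
    (tendsto_pi_nhds.2 hlim)
  have hXV : ∀ t, X t ∈ Icc 0 V := fun t =>
    isClosed_Icc.mem_of_tendsto (hlim t) (Eventually.of_forall fun k => (hZbox k).2 t)
  have hfix : Ψ X = X := by
    ext t i
    refine tendsto_nhds_unique ?_
      ((tendsto_pi_nhds.1 (hlim t) i).comp (tendsto_add_atTop_nat 1))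
    have h1 : (fun k => Z k t i) ∘ (fun k => k + 1) = fun k => Ψ (Z k) t i := by
      ext k
      simp only [Function.comp_apply, hZs]
    rw [h1]
    refine Tendsto.const_mul _ (Tendsto.const_add _ ?_)
    obtain ⟨K, hK⟩ := exists_mildIntegrand_bound hf hg c θ V
    refine intervalIntegral.tendsto_integral_filter_of_dominated_convergence
      (fun s => Real.exp (c * s) * K) ?_ ?_ (Continuous.intervalIntegrable (by fun_prop) _ _) ?_
    · exact Eventually.of_forall fun k =>
        (measurable_mildIntegrand hf hg hθ (hZbox k).1 i).aestronglyMeasurable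
    · exact Eventually.of_forall fun k => Eventually.of_forall fun s _ =>
        hK _ (hZbox k).2 i s
    · refine Eventually.of_forall fun s _ => Tendsto.const_mul _ ?_
      refine Tendsto.add (Tendsto.add ?_ (Tendsto.const_mul _ ?_)) ?_
      · exact tendsto_pi_nhds.1 ((hf.tendsto _).comp (hlim s)) i
      · exact tendsto_pi_nhds.1 (hlim s) i
      · exact tendsto_pi_nhds.1 ((hg.tendsto _).comp (hlim (θ s))) i
  refine ⟨X, ?_, hfix⟩
  -- The pointwise limit is a priori only measurable; the fixed-point identity makes it continuous.
  rw [← hfix]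
  exact continuous_mildMap hf hg hθ hψ hXm hXV

/-- Differentiating the exponential prefactor yields `-c • X`, which cancels the linear term added
to `f`. -/
theorem hasDerivWithinAt_of_mildMap_eq (hf : Continuous f) (hg : Continuous g) (hθ : Continuous θ)
    (hψ : ∀ t, 0 ≤ t → ψ t = ψ 0) (hX : Continuous X) (hfix : mildMap f g c θ ψ X = X) {t : ℝ}
    (ht : 0 ≤ t) : HasDerivWithinAt X (f (X t) + g (X (θ t))) (Ici 0) t := by
  refine hasDerivWithinAt_pi.2 fun i => ?_
  have hcont : Continuous (mildIntegrand f g c θ X i) := by unfold mildIntegrand; fun_prop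
  have heq : ∀ s ∈ Ici (0 : ℝ), X s i =
      Real.exp (-(c * s)) * (ψ 0 i + ∫ u in (0 : ℝ)..s, mildIntegrand f g c θ X i u) := by
    intro s hs
    have h := congrFun (congrFun hfix s) i
    rw [mildMap, max_eq_left hs, hψ s hs] at h
    exact h.symm
  have h1 : HasDerivAt (fun s => ∫ u in (0 : ℝ)..s, mildIntegrand f g c θ X i u)
      (mildIntegrand f g c θ X i t) t :=
    intervalIntegral.integral_hasDerivAt_right (hcont.intervalIntegrable _ _)
      (hcont.stronglyMeasurableAtFilter _ _) hcont.continuousAt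
  have h2 : HasDerivAt (fun s : ℝ => Real.exp (-(c * s))) (Real.exp (-(c * t)) * (-c)) t := by
    simpa using (((hasDerivAt_id t).const_mul c).neg).exp
  have h3 := ((h2.mul (h1.const_add (ψ 0 i))).hasDerivWithinAt (s := Ici 0)).congr heq (heq t ht)
  refine h3.congr_deriv ?_
  have h4 : Real.exp (-(c * t)) * Real.exp (c * t) = 1 := by
    rw [← Real.exp_add, neg_add_cancel, Real.exp_zero]
  have h5 := heq t ht
  rw [Pi.add_apply]
  simp only [mildIntegrand]
  simp only [mildIntegrand] at h5
  linear_combination c * h5 + (f (X t) i + c * X t i + g (X (θ t)) i) * h4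

end Mild

theorem exists_isSolution {f g : (Fin n → ℝ) → (Fin n → ℝ)} {c : ℝ} {V : Fin n → ℝ} {τ : ℝ → ℝ}
    {φ : ℝ → Fin n → ℝ} (hf : Continuous f) (hg : Continuous g) (hf0 : f 0 = 0) (hg0 : g 0 = 0)
    (hg_mono : IsNondecreasingField g)
    (hshift : ∀ x y : Fin n → ℝ, 0 ≤ x → x ≤ y → y ≤ V → ∀ i, f x i + c * x i ≤ f y i + c * y i)
    (hV0 : 0 ≤ V) (hV : ∀ i, f V i + g V i ≤ 0) (hτ : IsAdmissibleDelay τ)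
    (hφ : IsNonnegInitial τ φ) (hφV : ∀ s ∈ Icc (-maxDelay τ) 0, φ s ≤ V) :
    ∃ x, IsSolution f g τ φ x := by
  have hτ0 : -maxDelay τ ≤ 0 := by linarith [hτ.maxDelay_nonneg]
  set θ : ℝ → ℝ := fun s => max s 0 - τ (max s 0) with hθ
  have hθc : Continuous θ := by
    have h : Continuous fun s : ℝ => max s 0 := continuous_id.max continuous_const
    exact h.sub (hτ.continuousOn.comp_continuous h fun s => mem_Ici.2 (le_max_right _ _))
  -- Clamping time to the history interval extends `φ` continuously to the line, constant for `t ≥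
  -- 0`; likewise `θ` ignores the arbitrary values of `τ` at negative times.
  set π : ℝ → ℝ := fun t => max (-maxDelay τ) (min t 0) with hπ
  have hπmem : ∀ t, π t ∈ Icc (-maxDelay τ) 0 := fun t =>
    ⟨le_max_left _ _, max_le hτ0 (min_le_right _ _)⟩
  have hψc : Continuous fun t => φ (π t) :=
    hφ.continuousOn.comp_continuous (by fun_prop) hπmem
  obtain ⟨X, hXc, hX⟩ := exists_mildMap_fixedPoint (c := c) (ψ := fun t => φ (π t)) hf hg hθc
    hf0 hg0 hg_mono hshift hV0 hV hψc fun t => ⟨hφ.nonneg _ (hπmem t), hφV _ (hπmem t)⟩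
  refine ⟨X, fun s hs => ?_, fun t ht => ?_⟩
  · rw [← hX]
    ext i
    have hs' : π s = s := by rw [hπ]; simp only; rw [min_eq_left hs.2, max_eq_right hs.1]
    simp [mildMap, max_eq_right hs.2, hs']
  · have := hasDerivWithinAt_of_mildMap_eq hf hg hθc
      (fun t ht => by simp only [hπ, min_eq_right ht, min_self]) hXc hX ht
    simpa only [hθ, max_eq_left ht] using this

/-! ### The two implications and the equivalence -/

theorem isGloballyAsymptoticallyStable_of_apply_neg {f g : (Fin n → ℝ) → (Fin n → ℝ)}
    {r : Fin n → ℝ} {p : ℝ}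
    (hr : ∀ i, 0 < r i) (hp : 0 ≤ p) (hf : IsRegularField f) (hg : IsRegularField g)
    (hf_coop : IsCooperative f) (hg_mono : IsNondecreasingField g)
    (hf_hom : IsHomogeneousField r p f) (hg_hom : IsHomogeneousField r p g)
    {v : Fin n → ℝ} (hv : ∀ i, 0 < v i) (hneg : ∀ i, f v i + g v i < 0)
    {τ : ℝ → ℝ} (hτ : IsAdmissibleDelay τ) : IsGloballyAsymptoticallyStable f g τ := by
  have hneg' := fun c (hc : c > 0) => dilation_apply_add hf_hom hg_hom hneg hc
  have hnn : ∀ φ, IsNonnegInitial τ φ → ∀ x, IsSolution f g τ φ x →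
      ∀ t, -maxDelay τ ≤ t → 0 ≤ x t := fun φ hφ x hx t ht =>
    hx.nonneg hr hp hf hg hf_coop hg_mono hf_hom hg_hom hτ hφ ht
  refine ⟨fun φ hφ => ?_, fun ε hε => ?_, fun φ hφ x hx => ?_⟩
  · obtain ⟨d, hd, hφd⟩ := exists_initial_le_dilation hr hv hφ
    obtain ⟨c, -, hc⟩ := exists_shift_monotone hr hp hf hf_coop hf_hom (dilation r d v)
    exact exists_isSolution hf.continuous hg.continuous hf.map_zero hg.map_zero hg_mono hc
      (dilation_nonneg hv hd) (fun i => (hneg' d hd i).le) hτ hφ hφd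
  · obtain ⟨d, hd, hdε⟩ := exists_dilation_lt (v := v) hr hε
    have hev : ∀ᶠ δ : ℝ in 𝓝[>] 0, ∀ i, δ < dilation r d v i := eventually_all.2 fun i =>
      (tendsto_id.mono_left nhdsWithin_le_nhds).eventually_lt_const
        (mul_pos (Real.rpow_pos_of_pos hd _) (hv i))
    obtain ⟨δ, hδ, hδ0⟩ := (hev.and self_mem_nhdsWithin).exists
    refine ⟨δ, hδ0, fun φ hφ hφδ x hx t ht => ?_⟩
    have ht' : -maxDelay τ ≤ t := by linarith [hτ.maxDelay_nonneg]
    have hle := hx.le_of_initial_le hf_coop hg_mono hτ (hnn φ hφ x hx) (hneg' d hd)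
      (fun s hs i => ((le_abs_self _).trans ((norm_le_pi_norm (φ s) i).trans
        (hφδ s hs).le)).trans (hδ i).le) ht'
    rw [pi_norm_lt_iff hε]
    intro i
    rw [Real.norm_of_nonneg (hnn φ hφ x hx t ht' i)]
    exact (hle i).trans_lt (hdε i)
  · exact hx.tendsto_zero hr hv hf.continuous hg.continuous hf_coop hg_mono hτ hφ
      (hnn φ hφ x hx) hneg'

/-- A nonzero subequilibrium `y` of `f + g` would bound its own solution from below, so the limit 0
would satisfy `y ≤ 0`. -/
theorem exists_apply_neg_of_isGloballyAsymptoticallyStable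
    {f g : (Fin n → ℝ) → (Fin n → ℝ)} (hf : IsRegularField f) (hg : IsRegularField g)
    (hf_coop : IsCooperative f) (hg_mono : IsNondecreasingField g)
    (h : IsGloballyAsymptoticallyStable f g (fun _ => 0)) :
    ∃ v : Fin n → ℝ, (∀ i, 0 < v i) ∧ ∀ i, f v i + g v i < 0 := by
  have hq : ∀ (x y : Fin n → ℝ) (i : Fin n), 0 ≤ x → x ≤ y → x i = y i →
      (f + g) x i ≤ (f + g) y i := fun x y i hx hxy hi =>
    add_le_add (le_of_nonneg_of_eq_coord hf_coop hx hxy hi) (hg_mono y x hx hxy i)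
  refine exists_pos_apply_neg (h := f + g) (hf.continuous.add hg.continuous)
    (by simp [hf.map_zero, hg.map_zero]) hq fun y hy hy0 hhy => hy0 ?_
  have hφ : IsNonnegInitial (fun _ => 0) (fun _ => y) := ⟨continuousOn_const, fun _ _ => hy⟩
  obtain ⟨x, hx⟩ := h.exists_solution _ hφ
  have hx0 : x 0 = y :=
    hx.initial 0 ⟨by linarith [isAdmissibleDelay_zero.maxDelay_nonneg], le_rfl⟩
  have hle : ∀ t, 0 ≤ t → y ≤ x t := fun t ht =>
    le_of_subequilibrium (h := f + g) (hf.contDiffOn.add hg.contDiffOn) hq hy hy0 hhy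
      (fun s hs => by simpa using hx.deriv s hs) hx0 ht
  exact le_antisymm (ge_of_tendsto (h.attractive _ hφ x hx) ((eventually_ge_atTop 0).mono hle)) hy

end

theorem mainTheorem1 (n : ℕ) (f g : (Fin n → ℝ) → (Fin n → ℝ)) (r : Fin n → ℝ) (p : ℝ)
    (hr : ∀ i, 0 < r i) (hp : 0 ≤ p)
    (hf : IsRegularField f) (hg : IsRegularField g)
    (hf_coop : IsCooperative f) (hg_mono : IsNondecreasingField g)
    (hf_hom : IsHomogeneousField r p f) (hg_hom : IsHomogeneousField r p g) :
    List.TFAE [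
      ∃ v : Fin n → ℝ, (∀ i, 0 < v i) ∧ ∀ i, f v i + g v i < 0,
      ∀ τ : ℝ → ℝ, IsAdmissibleDelay τ → IsGloballyAsymptoticallyStable f g τ,
      IsGloballyAsymptoticallyStable f g (fun _ => 0)] := by
  tfae_have 1 → 2 := fun ⟨_, hv, hneg⟩ _ hτ =>
    isGloballyAsymptoticallyStable_of_apply_neg hr hp hf hg hf_coop hg_mono hf_hom hg_hom hv hneg hτ
  tfae_have 2 → 3 := fun h => h _ isAdmissibleDelay_zero
  tfae_have 3 → 1 := exists_apply_neg_of_isGloballyAsymptoticallyStable hf hg hf_coop hg_mono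
  tfae_finish
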